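/- Let $\mathfrak S_2$ be the Siegel upper half-space of degree $2$. A characteristic is $m=(m',m'')\in\{0,1\}^2\times\{0,1\}^2$, added modulo $2$; it is even (odd) if ${}^tm'm''$ is even (odd). There are ten even and six odd characteristics. For $\tau\in\mathfrak S_2$, $z\in\mathbb C^2$ let $$\theta_m(\tau,z)=\sum_{n\in\mathbb Z^2}\exp\Bigl(\pi i\Bigl[{}^t\bigl(n+\tfrac{m'}2\bigr)\tau\bigl(n+\tfrac{m'}2\bigr)+2\,{}^t\bigl(n+\tfrac{m'}2\bigr)\bigl(z+\tfrac{m''}2\bigr)\Bigr]\Bigr),\qquad \theta_m(\tau)=\theta_m(\tau,0),$$ and let $\chi_5=\prod_{m\ \mathrm{even}}\theta_m(\tau)$. For odd $n\ne n'$ the Jacobian determinant is $$D(n,n')(\tau)=\frac1{\pi^2}\det\begin{pmatrix}\partial_{z_1}\theta_n(\tau,0)&\partial_{z_2}\theta_n(\tau,0)\\ \partial_{z_1}\theta_{n'}(\tau,0)&\partial_{z_2}\theta_{n'}(\tau,0)\end{pmatrix};$$ since $D(n',n)=-D(n,n')$, it is determined up to sign by the couple $\{n,n'\}$. Let $C_4^-$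 be the collection of sets $M$ of four even characteristics such that the sum of any three distinct elements of $M$ is odd. By Jacobi's formula, each $D(n,n')$ equals $\pm\prod_{m\in M}\theta_m$ for some $M\in C_4^-$; the ordering $(n,n')$ is called normalised if the sign is $+$. Let $\{n_1,n_1'\},\dots,\{n_k,n_k'\}$ be pairwise distinct couples of distinct odd characteristics and let $P=\prod_{i=1}^kD(n_i,n_i')$. $P$ is called a remarkable factor if $\sum_{i=1}^k\sum_{m\in M_i}m\equiv0 \pmod 2$, where $M_i\in C_4^-$ and $D(n_i,n_i')=\pm\prod_{m\in M_i}\theta_m$. Then: 1. $P$ is a remarkable factor if and only if $\sum_{i=1}^k(n_i+n_i')\equiv0\pmod 2$. 2. $P$ is a remarkable factor if and only if there are $h\in\{0,1\}$ and integers $e_m\ge0$ such that, as functions on $\mathfrak S_2$, $$P=\pm\,\chi_5^{\,h}\prod_{m\ \mathrm{even}}\theta_m^{2e_m}.$$ 3. If all the orderings $(n_i,n_i')$ are normalised, then $P$ is a remarkable factor if and only if there are $h\in\{0,1\}$ and integers $e_m\ge0$ such that $P=\chi_5^{\,h}\prod_{m\ \mathrm{even}}\theta_m^{2e_m}$ on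 $\mathfrak S_2$. -/

import Mathlib

noncomputable section

namespace ThetaGenusTwo

/-- The Siegel upper half-space of degree `g`: complex symmetric `g × g` matrices with positive
definite imaginary part. -/
def SiegelUpperHalfSpace (g : ℕ) : Type :=
  {τ : Matrix (Fin g) (Fin g) ℂ // τ.IsSymm ∧ (τ.map Complex.im).PosDef}

/-- `g`-characteristics `m = [m' ; m'']`, with `m', m''` vectors over `ℤ/2`. -/
abbrev Characteristic (g : ℕ) : Type := (Fin g → ZMod 2) × (Fin g → ZMod 2)

/-- `m` is even if `ᵗm' m'' = 0` in `ℤ/2`. -/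
def Characteristic.IsEven {g : ℕ} (m : Characteristic g) : Prop := m.1 ⬝ᵥ m.2 = 0

/-- `m` is odd if `ᵗm' m'' = 1` in `ℤ/2`. -/
def Characteristic.IsOdd {g : ℕ} (m : Characteristic g) : Prop := m.1 ⬝ᵥ m.2 = 1

/-- The complex number `0` or `1` representing a residue class mod `2`. -/
def lift (x : ZMod 2) : ℂ := (x.val : ℂ)

/-- Riemann's Theta function with characteristic `m`:
`θ_m(τ, z) = ∑_{n ∈ ℤ^g} exp πi (ᵗ(n + m'/2) τ (n + m'/2) + 2 ᵗ(n + m'/2) (z + m''/2))`,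
the entries of `m` being represented by `0` and `1`. -/
def riemannTheta {g : ℕ} (m : Characteristic g) (τ : SiegelUpperHalfSpace g)
    (z : Fin g → ℂ) : ℂ :=
  ∑' n : Fin g → ℤ,
    let x : Fin g → ℂ := fun i => (n i : ℂ) + lift (m.1 i) / 2
    let w : Fin g → ℂ := fun i => z i + lift (m.2 i) / 2
    Complex.exp (Real.pi * Complex.I * (x ⬝ᵥ τ.1.mulVec x + 2 * (x ⬝ᵥ w)))

/-- The Theta constant `θ_m(τ) = θ_m(τ, 0)`, as a function on the Siegel upper half-space. -/
def thetaConstant {g : ℕ} (m : Characteristic g) : SiegelUpperHalfSpace g → ℂ :=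
  fun τ => riemannTheta m τ 0

/-- The `j`-th entry `∂θ_m/∂z_j (τ, 0)` of the gradient of the Theta function at `z = 0`. -/
def thetaGradient {g : ℕ} (m : Characteristic g) (τ : SiegelUpperHalfSpace g) (j : Fin g) : ℂ :=
  deriv (fun t : ℂ => riemannTheta m τ (Pi.single j t)) 0

/-- The Jacobian determinant `D(n, n')`: `π⁻²` times the determinant of the `2 × 2` matrix whose
rows are the gradients at `z = 0` of the Theta functions with characteristics `n` and `n'`. -/
def jacobianDet (n n' : Characteristic 2) : SiegelUpperHalfSpace 2 → ℂ :=
  fun τ => 1 / (Real.pi : ℂ) ^ 2 * Matrix.det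
    !![thetaGradient n τ 0, thetaGradient n τ 1;
       thetaGradient n' τ 0, thetaGradient n' τ 1]

open Classical in
/-- `C₁`: the set of the (ten) even `2`-characteristics. -/
def evenCharacteristics : Finset (Characteristic 2) :=
  Finset.univ.filter fun m => m.IsEven

/-- `C₃⁻`: the sets of three even `2`-characteristics whose sum is odd. -/
def C3Minus : Set (Finset (Characteristic 2)) :=
  {T | T.card = 3 ∧ (∀ m ∈ T, m.IsEven) ∧ (∑ m ∈ T, m).IsOdd}

/-- `C₄⁻`: the sets of four even `2`-characteristics all of whose triples lie in `C₃⁻`. -/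
def C4Minus : Set (Finset (Characteristic 2)) :=
  {M | M.card = 4 ∧ (∀ m ∈ M, m.IsEven) ∧ ∀ T ⊆ M, T.card = 3 → T ∈ C3Minus}

/-- `χ₅`: the product of the ten even Theta constants. -/
def chi5 : SiegelUpperHalfSpace 2 → ℂ :=
  ∏ m ∈ evenCharacteristics, thetaConstant m

/-- `M ∈ C₄⁻` is the `4`-plet of the Jacobian determinant `D(n, n')` if
`D(n, n') = θ_{m₁} θ_{m₂} θ_{m₃} θ_{m₄}`, where `M = {m₁, m₂, m₃, m₄}`, up to the sign that
depends on the order of `n` and `n'`. -/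
def IsFourPlet (n n' : Characteristic 2) (M : Finset (Characteristic 2)) : Prop :=
  M ∈ C4Minus ∧
    (jacobianDet n n' = ∏ m ∈ M, thetaConstant m ∨
      jacobianDet n n' = -∏ m ∈ M, thetaConstant m)

/-- The ordering `(n, n')` is normalised if `D(n, n') = θ_{m₁} θ_{m₂} θ_{m₃} θ_{m₄}`, with
sign `+`, for some `{m₁, m₂, m₃, m₄} ∈ C₄⁻`. -/
def IsNormalised (n n' : Characteristic 2) : Prop :=
  ∃ M ∈ C4Minus, jacobianDet n n' = ∏ m ∈ M, thetaConstant m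

/-- The product `D(n₁, n₁') ⋯ D(n_k, n_k')` is a remarkable factor: the sum of all the even
characteristics in the `4`-plets `M₁, …, M_k` of its factors, counted with multiplicity, is
zero mod `2`. -/
def IsRemarkableFactor {k : ℕ} (n n' : Fin k → Characteristic 2) : Prop :=
  ∃ M : Fin k → Finset (Characteristic 2),
    (∀ i, IsFourPlet (n i) (n' i) (M i)) ∧ ∑ i, ∑ m ∈ M i, m = 0

/-- The monomial `χ₅^h ∏_m θ_m^{2 e(m)}` in `χ₅` and the squares of the even Theta constants. -/
def chiThetaMonomial (h : ℕ) (e : Characteristic 2 → ℕ) : SiegelUpperHalfSpace 2 → ℂ :=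
  chi5 ^ h * ∏ m ∈ evenCharacteristics, (thetaConstant m ^ 2) ^ e m

end ThetaGenusTwo

end

noncomputable section

namespace ThetaGenusTwo

open Filter Topology

/-! Put s_i = n_i + n_i'. Everything rests on an explicit form of Jacobi's derivative formula: D(n,
n') is, up to sign, the product of θ_m over `fourPlet (n + n')`, the even m for which m + n + n' is
odd (`jacobianDet_eq_prod`). A finite check shows that these are four characteristics whose sum is n
+ n'. The 4-plet of D(n, n') is unique: two proportional monomials in the even theta constants have
the same weighted sum of characteristics (`sum_smul_eq_of_prod_eq`), and a member of `C4Minus` is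
recovered from its sum (`eq_fourPlet_of_mem`). This gives the first equivalence.

For even m, membership in the 4-plet of s means that s's'' plus the symplectic pairing of m with s
equals 1. Summed over i, the exponent of θ_m in P is congruent to a constant plus the pairing of m
with ∑ s_i. If ∑ s_i = 0, all ten exponents have one parity h, so P is ± a monomial in χ₅ and
squares. Conversely, such a monomial has weighted characteristic sum h times the sum of the ten even
characteristics, which is 0. Normalised orderings make every sign +.

Jacobi's formula is derived from the duplication formula, which expresses products of theta
functions at τ through values at 2τ. For base pairs with a common second half, it shows that the
quotient of the Jacobian determinant by its theta product is invariant up to sign under τ ↦ 2τ;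
leading terms along 2^k τ then identify the constant. One further duplication reaches the remaining
pairs.

The multiplicative statement is obtained on diagonal matrices iT. There exactly one even theta
constant vanishes and the others split into positive genus-one theta constants, whose behaviour at ∞
and at 0 determines the relevant exponents. Cancellation and analytic continuation both use
holomorphy on complex lines and convexity of the half-space. -/

/-! ### Coordinates on the Siegel half-space and majorants for theta series. -/

/-- Coordinates `(τ₁₁, τ₁₂, τ₂₂)` of a symmetric `2 × 2` matrix. -/
abbrev SymCoord : Type := ℂ × ℂ × ℂ

/-- The Siegel upper half-space of degree `2` in the coordinates `(τ₁₁, τ₁₂, τ₂₂)`. -/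
def siegelCoord : Set SymCoord := {P | 0 < P.1.im ∧ P.2.1.im ^ 2 < P.1.im * P.2.2.im}

/-- The quadratic form with matrix `P`. -/
def quadForm (P : SymCoord) (x : ℂ × ℂ) : ℂ :=
  P.1 * x.1 ^ 2 + 2 * P.2.1 * x.1 * x.2 + P.2.2 * x.2 ^ 2

/-- The imaginary part of the quadratic form on real vectors. -/
def imForm (P : SymCoord) (x : ℝ × ℝ) : ℝ :=
  P.1.im * x.1 ^ 2 + 2 * P.2.1.im * x.1 * x.2 + P.2.2.im * x.2 ^ 2

/-- The point `n + a / 2`. -/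
def shiftPt (a n : ℤ × ℤ) : ℝ × ℝ := (n.1 + a.1 / 2, n.2 + a.2 / 2)

/-- A real point seen as a complex one. -/
def cpt (x : ℝ × ℝ) : ℂ × ℂ := (x.1, x.2)

/-- The summable majorant `exp (-|n₁|-|n₂|)`. -/
def expMajorant (n : ℤ × ℤ) : ℝ := Real.exp (-|(n.1 : ℝ)|) * Real.exp (-|(n.2 : ℝ)|)

lemma summable_exp_neg_abs : Summable fun n : ℤ => Real.exp (-|(n : ℝ)|) := by
  have h : Summable fun n : ℕ => Real.exp (-(n : ℝ)) := by
    simpa using Real.summable_exp_neg_nat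
  refine Summable.of_nat_of_neg ?_ ?_ <;> simpa using h

lemma summable_expMajorant : Summable expMajorant :=
  summable_exp_neg_abs.mul_of_nonneg summable_exp_neg_abs (fun _ => (Real.exp_pos _).le)
    (fun _ => (Real.exp_pos _).le)

lemma im_quadForm (P : SymCoord) (x : ℝ × ℝ) : (quadForm P (cpt x)).im = imForm P x := by
  simp only [quadForm, cpt, imForm, Complex.add_im]
  have h1 : (P.1 * (x.1 : ℂ) ^ 2).im = P.1.im * x.1 ^ 2 := by
    rw [← Complex.ofReal_pow, Complex.im_mul_ofReal]
  have h2 : (P.2.2 * (x.2 : ℂ) ^ 2).im = P.2.2.im * x.2 ^ 2 := by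
    rw [← Complex.ofReal_pow, Complex.im_mul_ofReal]
  have h3 : (2 * P.2.1 * (x.1 : ℂ) * x.2).im = 2 * P.2.1.im * x.1 * x.2 := by
    rw [Complex.im_mul_ofReal, Complex.im_mul_ofReal]
    simp
  rw [h1, h2, h3]

lemma norm_exp_quadForm (P : SymCoord) (x : ℝ × ℝ) :
    ‖Complex.exp (Real.pi * Complex.I * quadForm P (cpt x))‖ = Real.exp (-Real.pi * imForm P x) := by
  rw [Complex.norm_exp, ← im_quadForm]
  congr 1
  simp

/-- The smallest-eigenvalue bound `det / trace` of the imaginary part. -/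
def imBound (P : SymCoord) : ℝ :=
  (P.1.im * P.2.2.im - P.2.1.im ^ 2) / (P.1.im + P.2.2.im)

lemma im_pos_of_mem {P : SymCoord} (hP : P ∈ siegelCoord) : 0 < P.2.2.im := by
  obtain ⟨h1, h2⟩ := hP
  by_contra h
  nlinarith [sq_nonneg P.2.1.im, mul_nonneg h1.le (neg_nonneg.mpr (not_lt.mp h))]

lemma imBound_pos {P : SymCoord} (hP : P ∈ siegelCoord) : 0 < imBound P := by
  have := im_pos_of_mem hP
  obtain ⟨h1, h2⟩ := hP
  unfold imBound
  apply div_pos <;> linarith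

/-- For Y the imaginary part, Cayley–Hamilton gives tr(Y)·ᵗxYx − det(Y)·|x|² = |Yx|² ≥ 0. -/
lemma imBound_le {P : SymCoord} (hP : P ∈ siegelCoord) (x : ℝ × ℝ) :
    imBound P * (x.1 ^ 2 + x.2 ^ 2) ≤ imForm P x := by
  have h3 := im_pos_of_mem hP
  obtain ⟨h1, h2⟩ := hP
  unfold imBound imForm
  set A := P.1.im
  set B := P.2.2.im
  set q := P.2.1.im
  have hs : 0 < A + B := by linarith
  rw [div_mul_eq_mul_div, div_le_iff₀ hs]
  have e : (A * x.1 ^ 2 + 2 * q * x.1 * x.2 + B * x.2 ^ 2) * (A + B) -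
      (A * B - q ^ 2) * (x.1 ^ 2 + x.2 ^ 2) = (A * x.1 + q * x.2) ^ 2 + (q * x.1 + B * x.2) ^ 2 := by
    ring
  nlinarith [sq_nonneg (A * x.1 + q * x.2), sq_nonneg (q * x.1 + B * x.2)]

lemma isOpen_siegelCoord : IsOpen siegelCoord := by
  have : siegelCoord = {P : SymCoord | 0 < P.1.im} ∩
      {P : SymCoord | P.2.1.im ^ 2 < P.1.im * P.2.2.im} := rfl
  rw [this]
  have h1 : Continuous fun P : SymCoord => P.1.im := Complex.continuous_im.comp continuous_fst
  have h2 : Continuous fun P : SymCoord => P.2.1.im :=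
    Complex.continuous_im.comp (continuous_fst.comp continuous_snd)
  have h3 : Continuous fun P : SymCoord => P.2.2.im :=
    Complex.continuous_im.comp (continuous_snd.comp continuous_snd)
  exact (isOpen_lt continuous_const h1).inter (isOpen_lt (h2.pow 2) (h1.mul h3))

lemma mem_siegelCoord_iff {P : SymCoord} :
    P ∈ siegelCoord ↔ ∀ x : ℝ × ℝ, x ≠ 0 → 0 < imForm P x := by
  constructor
  · intro hP x hx
    refine lt_of_lt_of_le (mul_pos (imBound_pos hP) ?_) (imBound_le hP x)
    by_contra h
    apply hx
    have h1 : x.1 = 0 := by nlinarith [sq_nonneg x.1, sq_nonneg x.2]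
    have h2 : x.2 = 0 := by nlinarith [sq_nonneg x.1, sq_nonneg x.2]
    exact Prod.ext h1 h2
  · intro h
    have h1 : 0 < P.1.im := by simpa [imForm] using h (1, 0) (by simp)
    refine ⟨h1, ?_⟩
    -- With Y = (A, q; q, B), the form takes the value A(AB − q²) at the vector (q, −A).
    have h2 := h (P.2.1.im, -P.1.im) (by simp [h1.ne'])
    simp only [imForm] at h2
    have : 0 < P.1.im * (P.1.im * P.2.2.im - P.2.1.im ^ 2) := by nlinarith
    nlinarith [(mul_pos_iff_of_pos_left h1).mp this]

lemma convex_siegelCoord : Convex ℝ siegelCoord := by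
  intro P hP Q hQ s t hs ht hst
  rw [mem_siegelCoord_iff] at *
  intro x hx
  have e : imForm (s • P + t • Q) x = s * imForm P x + t * imForm Q x := by
    simp [imForm]; ring
  rw [e]
  have := hP x hx
  have := hQ x hx
  rcases hs.eq_or_lt with rfl | hs
  · have : t = 1 := by linarith
    subst this; simpa
  · positivity

lemma smul_mem_siegelCoord {P : SymCoord} (hP : P ∈ siegelCoord) {t : ℝ} (ht : 0 < t) :
    (t : ℂ) • P ∈ siegelCoord := by
  rw [mem_siegelCoord_iff] at *
  intro x hx
  have : imForm ((t : ℂ) • P) x = t * imForm P x := by simp [imForm]; ring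
  rw [this]
  exact mul_pos ht (hP x hx)

lemma exp_quadratic_le {c : ℝ} (hc : 0 < c) (C : ℝ) : ∃ K : ℝ, 0 < K ∧ ∀ y : ℝ,
    Real.exp (-Real.pi * (c * y ^ 2) + C * |y|) ≤ K * Real.exp (-|y|) := by
  -- The exponent of the constant is the maximum of (C + 1)|y| − πc y², found by completing the
  -- square.
  refine ⟨Real.exp ((C + 1) ^ 2 / (4 * (Real.pi * c))), Real.exp_pos _, fun y => ?_⟩
  rw [← Real.exp_add, Real.exp_le_exp]
  have hp : 0 < Real.pi * c := mul_pos Real.pi_pos hc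
  have e : (C + 1) ^ 2 / (4 * (Real.pi * c)) + -|y| - (-Real.pi * (c * y ^ 2) + C * |y|) =
      (Real.pi * c) * (|y| - (C + 1) / (2 * (Real.pi * c))) ^ 2 := by
    rw [← sq_abs y]
    field_simp
    ring
  nlinarith [mul_nonneg hp.le (sq_nonneg (|y| - (C + 1) / (2 * (Real.pi * c))))]

/-- The uniform bound of a theta series with weights of exponential growth. -/
lemma exp_form_le (a : ℤ × ℤ) {c : ℝ} (hc : 0 < c) (C : ℝ) : ∃ K : ℝ, 0 < K ∧
    ∀ (P : SymCoord), (∀ x, c * (x.1 ^ 2 + x.2 ^ 2) ≤ imForm P x) → ∀ n : ℤ × ℤ,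
      Real.exp (C * (|(shiftPt a n).1| + |(shiftPt a n).2|)) *
        Real.exp (-Real.pi * imForm P (shiftPt a n)) ≤ K * expMajorant n := by
  obtain ⟨K, hK, h⟩ := exp_quadratic_le hc C
  refine ⟨K * K * (Real.exp (|(a.1 : ℝ) / 2|) * Real.exp (|(a.2 : ℝ) / 2|)), by positivity,
    fun P hP n => ?_⟩
  set x := shiftPt a n with hx
  have b (n a : ℝ) : Real.exp (-|n + a / 2|) ≤ Real.exp (|a / 2|) * Real.exp (-|n|) := by
    rw [← Real.exp_add, Real.exp_le_exp]
    have := abs_sub_abs_le_abs_sub n (-(a / 2))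
    rw [abs_neg, sub_neg_eq_add] at this
    linarith
  have b1 : Real.exp (-|x.1|) ≤ _ := b n.1 a.1
  have b2 : Real.exp (-|x.2|) ≤ _ := b n.2 a.2
  calc _ ≤ Real.exp (-Real.pi * (c * x.1 ^ 2) + C * |x.1|) *
        Real.exp (-Real.pi * (c * x.2 ^ 2) + C * |x.2|) := by
        rw [← Real.exp_add, ← Real.exp_add, Real.exp_le_exp]
        have := mul_le_mul_of_nonneg_left (hP x) Real.pi_pos.le
        nlinarith
    _ ≤ (K * Real.exp (-|x.1|)) * (K * Real.exp (-|x.2|)) :=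
        mul_le_mul (h _) (h _) (Real.exp_pos _).le (by positivity)
    _ ≤ (K * (Real.exp (|(a.1 : ℝ) / 2|) * Real.exp (-|(n.1 : ℝ)|))) *
        (K * (Real.exp (|(a.2 : ℝ) / 2|) * Real.exp (-|(n.2 : ℝ)|))) := by gcongr
    _ = _ := by unfold expMajorant; ring

/-- Weights of at most exponential growth. -/
def ExpGrowth (a : ℤ × ℤ) (W : ℤ × ℤ → ℂ) : Prop :=
  ∃ C K : ℝ, 0 ≤ K ∧ ∀ n, ‖W n‖ ≤ K * Real.exp (C * (|(shiftPt a n).1| + |(shiftPt a n).2|))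

/-- The general term of a weighted theta series. -/
def wterm (a : ℤ × ℤ) (W : ℤ × ℤ → ℂ) (P : SymCoord) (n : ℤ × ℤ) : ℂ :=
  W n * Complex.exp (Real.pi * Complex.I * quadForm P (cpt (shiftPt a n)))

lemma ExpGrowth.bound {a : ℤ × ℤ} {W : ℤ × ℤ → ℂ} (hW : ExpGrowth a W) {c : ℝ} (hc : 0 < c) :
    ∃ u : ℤ × ℤ → ℝ, Summable u ∧ ∀ (P : SymCoord),
      (∀ x, c * (x.1 ^ 2 + x.2 ^ 2) ≤ imForm P x) → ∀ n, ‖wterm a W P n‖ ≤ u n := by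
  obtain ⟨C, K, hK, h⟩ := hW
  obtain ⟨K', hK', h'⟩ := exp_form_le a hc C
  refine ⟨fun n => K * (K' * expMajorant n), (summable_expMajorant.mul_left _).mul_left _,
    fun P hP n => ?_⟩
  rw [wterm, norm_mul, norm_exp_quadForm]
  calc _ ≤ K * Real.exp (C * (|(shiftPt a n).1| + |(shiftPt a n).2|)) *
        Real.exp (-Real.pi * imForm P (shiftPt a n)) := by gcongr; exact h n
    _ ≤ _ := by
      rw [mul_assoc]
      exact mul_le_mul_of_nonneg_left (h' P hP n) hK

lemma ExpGrowth.summable_norm {a : ℤ × ℤ} {W : ℤ × ℤ → ℂ} (hW : ExpGrowth a W) {P : SymCoord}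
    (hP : P ∈ siegelCoord) : Summable fun n => ‖wterm a W P n‖ := by
  obtain ⟨u, hu, h⟩ := hW.bound (imBound_pos hP)
  exact Summable.of_nonneg_of_le (fun _ => norm_nonneg _) (h P (imBound_le hP)) hu

/-! ### Holomorphy along complex lines and cancellation. -/

/-- A function on the Siegel space that is holomorphic on all complex lines. -/
def LineHolo (F : SymCoord → ℂ) : Prop :=
  ∀ P V : SymCoord, DifferentiableOn ℂ (fun w : ℂ => F (P + w • V)) {w | P + w • V ∈ siegelCoord}

lemma isOpen_line (P V : SymCoord) : IsOpen {w : ℂ | P + w • V ∈ siegelCoord} :=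
  isOpen_siegelCoord.preimage (by fun_prop)

lemma convex_line (P V : SymCoord) : Convex ℝ {w : ℂ | P + w • V ∈ siegelCoord} := by
  intro v hv w hw s t hs ht hst
  have := convex_siegelCoord hv hw hs ht hst
  have e : s • (P + v • V) + t • (P + w • V) = P + (s • v + t • w) • V := by
    have : s • P + t • P = P := by rw [← add_smul, hst, one_smul]
    rw [smul_add, smul_add, add_smul, smul_assoc, smul_assoc]
    nth_rewrite 3 [← this]
    abel
  rw [e] at this
  exact this

lemma continuousOn_imBound : ContinuousOn imBound siegelCoord := by
  unfold imBound
  refine ContinuousOn.div ?_ ?_ ?_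
  · exact Continuous.continuousOn (((Complex.continuous_im.comp continuous_fst).mul
      (Complex.continuous_im.comp (continuous_snd.comp continuous_snd))).sub
      ((Complex.continuous_im.comp (continuous_fst.comp continuous_snd)).pow 2))
  · exact Continuous.continuousOn ((Complex.continuous_im.comp continuous_fst).add
      (Complex.continuous_im.comp (continuous_snd.comp continuous_snd)))
  · intro P hP
    have := im_pos_of_mem hP
    have := hP.1
    positivity

/-- Near a point of the line the eigenvalue bound stays above half its value there, so one summable
majorant serves a whole neighbourhood. -/
lemma ExpGrowth.lineHolo {a : ℤ × ℤ} {W : ℤ × ℤ → ℂ} (hW : ExpGrowth a W) :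
    LineHolo fun P => ∑' n, wterm a W P n := by
  intro P V w0 hw0
  have hw0' : P + w0 • V ∈ siegelCoord := hw0
  set c := imBound (P + w0 • V) with hc
  have hc0 : 0 < c := imBound_pos hw0
  have hopen : IsOpen {w : ℂ | P + w • V ∈ siegelCoord ∧ c / 2 < imBound (P + w • V)} := by
    have : ContinuousOn (fun w : ℂ => imBound (P + w • V)) {w : ℂ | P + w • V ∈ siegelCoord} :=
      continuousOn_imBound.comp (by fun_prop) (fun w hw => hw)
    exact this.isOpen_inter_preimage (isOpen_line P V) isOpen_Ioi
  obtain ⟨u, hu, h⟩ := hW.bound (half_pos hc0)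
  have hd : DifferentiableOn ℂ (fun w : ℂ => ∑' n, wterm a W (P + w • V) n)
      {w : ℂ | P + w • V ∈ siegelCoord ∧ c / 2 < imBound (P + w • V)} := by
    refine Complex.differentiableOn_tsum_of_summable_norm hu (fun n => ?_) hopen (fun n w hw => ?_)
    · unfold wterm quadForm
      simp only [Prod.fst_add, Prod.snd_add, Prod.smul_fst, Prod.smul_snd, smul_eq_mul]
      fun_prop
    · refine h _ (fun x => ?_) n
      refine le_trans ?_ (imBound_le hw.1 x)
      have := hw.2
      gcongr
  exact (hd.differentiableAt (hopen.mem_nhds ⟨hw0, by linarith⟩)).differentiableWithinAt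

lemma LineHolo.mul {F G : SymCoord → ℂ} (hF : LineHolo F) (hG : LineHolo G) :
    LineHolo (fun P => F P * G P) := fun P V => (hF P V).mul (hG P V)

lemma LineHolo.sub {F G : SymCoord → ℂ} (hF : LineHolo F) (hG : LineHolo G) :
    LineHolo (fun P => F P - G P) := fun P V => (hF P V).sub (hG P V)

lemma LineHolo.const (c : ℂ) : LineHolo (fun _ => c) := fun _ _ => differentiableOn_const c

lemma LineHolo.pow {F : SymCoord → ℂ} (hF : LineHolo F) (k : ℕ) :
    LineHolo (fun P => F P ^ k) := fun P V => (hF P V).pow k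

lemma LineHolo.prod {ι : Type*} (s : Finset ι) {F : ι → SymCoord → ℂ}
    (hF : ∀ i ∈ s, LineHolo (F i)) : LineHolo (fun P => ∏ i ∈ s, F i P) :=
  fun P V => DifferentiableOn.fun_finsetProd fun i hi => hF i hi P V

lemma LineHolo.comp_smul {F : SymCoord → ℂ} (hF : LineHolo F) {t : ℝ} (ht : 0 < t) :
    LineHolo (fun P => F ((t : ℂ) • P)) := by
  intro P V
  refine (hF ((t : ℂ) • P) ((t : ℂ) • V)).congr_mono (fun w _ => ?_) (fun w hw => ?_)
  · simp only [smul_add, smul_comm w]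
  · have := smul_mem_siegelCoord hw ht
    simpa [smul_add, smul_comm w] using this

/-- Identity theorem along the lines through a point. -/
lemma LineHolo.eq_zero {F : SymCoord → ℂ} (hF : LineHolo F) {P₀ : SymCoord}
    (hP₀ : P₀ ∈ siegelCoord) (h : ∀ V : SymCoord, ∀ᶠ w in 𝓝 (0 : ℂ), F (P₀ + w • V) = 0)
    {P : SymCoord} (hP : P ∈ siegelCoord) : F P = 0 := by
  have hl := (hF P₀ (P - P₀)).analyticOnNhd (isOpen_line _ _)
  have := hl.eqOn_zero_of_preconnected_of_eventuallyEq_zero (convex_line _ _).isPreconnected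
    (z₀ := 0) (by simpa using hP₀) (h _)
  simpa using this (x := 1) (by simpa using hP)

/-- Functions of this kind have no zero divisors: near a point where G is nonzero F vanishes along
every line, and the identity theorem spreads this by convexity. -/
lemma LineHolo.eq_zero_of_mul {F G : SymCoord → ℂ} (hF : LineHolo F) (hG : LineHolo G)
    (h : ∀ P ∈ siegelCoord, F P * G P = 0) (hG0 : ∃ P ∈ siegelCoord, G P ≠ 0)
    {P : SymCoord} (hP : P ∈ siegelCoord) : F P = 0 := by
  obtain ⟨P₀, hP₀, hne⟩ := hG0
  refine hF.eq_zero hP₀ (fun V => ?_) hP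
  have hmem : {w : ℂ | P₀ + w • V ∈ siegelCoord} ∈ 𝓝 (0 : ℂ) :=
    (isOpen_line P₀ V).mem_nhds (by simpa using hP₀)
  have hc : ContinuousAt (fun w : ℂ => G (P₀ + w • V)) 0 :=
    (hG P₀ V).continuousOn.continuousAt hmem
  have hne' : ∀ᶠ w in 𝓝 (0 : ℂ), G (P₀ + w • V) ≠ 0 := hc.eventually_ne (by simpa using hne)
  filter_upwards [hmem, hne'] with w hw hw'
  exact (mul_eq_zero.mp (h _ hw)).resolve_right hw'

lemma LineHolo.eq_of_mul_eq {F F' G : SymCoord → ℂ} (hF : LineHolo F) (hF' : LineHolo F')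
    (hG : LineHolo G) (h : ∀ P ∈ siegelCoord, F P * G P = F' P * G P)
    (hG0 : ∃ P ∈ siegelCoord, G P ≠ 0) {P : SymCoord} (hP : P ∈ siegelCoord) : F P = F' P :=
  sub_eq_zero.mp ((hF.sub hF').eq_zero_of_mul hG
    (fun P hP => by rw [sub_mul, h P hP, sub_self]) hG0 hP)

lemma LineHolo.exists_mul_ne_zero {F G : SymCoord → ℂ} (hF : LineHolo F) (hG : LineHolo G)
    (hF0 : ∃ P ∈ siegelCoord, F P ≠ 0) (hG0 : ∃ P ∈ siegelCoord, G P ≠ 0) :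
    ∃ P ∈ siegelCoord, F P * G P ≠ 0 := by
  by_contra! h
  obtain ⟨P, hP, hne⟩ := hF0
  exact hne (hF.eq_zero_of_mul hG h hG0 hP)

lemma LineHolo.exists_pow_ne_zero {F : SymCoord → ℂ}
    (hF0 : ∃ P ∈ siegelCoord, F P ≠ 0) (k : ℕ) : ∃ P ∈ siegelCoord, F P ^ k ≠ 0 := by
  obtain ⟨P, hP, hne⟩ := hF0
  exact ⟨P, hP, pow_ne_zero _ hne⟩

/-! ### Theta series with integral characteristics and the duplication formula. -/

/-- The linear form in the exponent of the theta series. -/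
def thetaLin (a b n : ℤ × ℤ) (z : ℂ × ℂ) : ℂ :=
  ((shiftPt a n).1 : ℂ) * (z.1 + b.1 / 2) + ((shiftPt a n).2 : ℂ) * (z.2 + b.2 / 2)

/-- The factor of the theta series that is linear in the exponent. -/
def thetaWeight (a b : ℤ × ℤ) (z : ℂ × ℂ) (n : ℤ × ℤ) : ℂ :=
  Complex.exp (Real.pi * Complex.I * (2 * thetaLin a b n z))

/-- The theta series with an integral characteristic. -/
def thetaInt (a b : ℤ × ℤ) (P : SymCoord) (z : ℂ × ℂ) : ℂ :=
  ∑' n, wterm a (thetaWeight a b z) P n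

/-- The shift b/2 is real and contributes only a phase; the growth comes from Im z. -/
lemma norm_thetaWeight_le (a b : ℤ × ℤ) (z : ℂ × ℂ) (n : ℤ × ℤ) :
    ‖thetaWeight a b z n‖ ≤ Real.exp (2 * Real.pi * (‖z.1‖ + ‖z.2‖) *
      (|(shiftPt a n).1| + |(shiftPt a n).2|)) := by
  unfold thetaWeight thetaLin
  set x := shiftPt a n
  rw [Complex.norm_exp, Real.exp_le_exp]
  have e : (Real.pi * Complex.I * (2 * ((x.1 : ℂ) * (z.1 + b.1 / 2) + x.2 * (z.2 + b.2 / 2)))).re =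
      2 * Real.pi * (-(x.1 * z.1.im) - x.2 * z.2.im) := by
    have e1 : (b.1 / 2 : ℂ) = ((b.1 / 2 : ℝ) : ℂ) := by push_cast; rfl
    have e2 : (b.2 / 2 : ℂ) = ((b.2 / 2 : ℝ) : ℂ) := by push_cast; rfl
    rw [e1, e2]
    simp only [Complex.mul_re, Complex.mul_im, Complex.add_im, Complex.add_re, Complex.ofReal_re,
      Complex.ofReal_im, Complex.I_re, Complex.I_im, Complex.re_ofNat, Complex.im_ofNat]
    ring
  rw [e, mul_assoc (2 * Real.pi)]
  refine mul_le_mul_of_nonneg_left ?_ Real.two_pi_pos.le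
  have h1 : -(x.1 * z.1.im) ≤ |x.1| * ‖z.1‖ := by
    refine (neg_le_abs _).trans ?_
    rw [abs_mul]
    exact mul_le_mul_of_nonneg_left (Complex.abs_im_le_norm _) (abs_nonneg _)
  have h2 : -(x.2 * z.2.im) ≤ |x.2| * ‖z.2‖ := by
    refine (neg_le_abs _).trans ?_
    rw [abs_mul]
    exact mul_le_mul_of_nonneg_left (Complex.abs_im_le_norm _) (abs_nonneg _)
  nlinarith [abs_nonneg x.1, abs_nonneg x.2, norm_nonneg z.1, norm_nonneg z.2,
    mul_nonneg (abs_nonneg x.1) (norm_nonneg z.2), mul_nonneg (abs_nonneg x.2) (norm_nonneg z.1)]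

lemma expGrowth_thetaWeight (a b : ℤ × ℤ) (z : ℂ × ℂ) : ExpGrowth a (thetaWeight a b z) :=
  ⟨_, 1, zero_le_one, fun n => by rw [one_mul]; exact norm_thetaWeight_le a b z n⟩

lemma wterm_thetaWeight (a b : ℤ × ℤ) (P : SymCoord) (z : ℂ × ℂ) (n : ℤ × ℤ) :
    wterm a (thetaWeight a b z) P n = Complex.exp (Real.pi * Complex.I *
      (quadForm P (cpt (shiftPt a n)) + 2 * thetaLin a b n z)) := by
  rw [wterm, thetaWeight, ← Complex.exp_add]
  congr 1
  ring

/-- Integral representatives of a vector over `ℤ/2`. -/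
def intLift (v : Fin 2 → ZMod 2) : ℤ × ℤ := ((v 0).val, (v 1).val)

/-- The bit is the parity of the difference of the two integers; once it is fixed, half-sum and
half-difference are integral. -/
lemma bijective_sum_diff : Function.Bijective
    fun t : ZMod 2 × ℤ × ℤ => (t.2.1 + t.2.2 + (t.1.val : ℤ), t.2.1 - t.2.2) := by
  constructor
  · rintro ⟨e, p, r⟩ ⟨e', p', r'⟩ h
    simp only [Prod.mk.injEq] at h
    have h1 := ZMod.val_lt e
    have h2 := ZMod.val_lt e'
    have : e.val = e'.val := by omega
    have he : e = e' := ZMod.val_injective 2 this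
    subst he
    simp only [Prod.mk.injEq, true_and]
    omega
  · rintro ⟨n, n'⟩
    have h : ((((n - n' : ℤ) : ZMod 2)).val : ℤ) = (n - n') % 2 := by
      rw [ZMod.val_intCast]; rfl
    refine ⟨(((n - n' : ℤ) : ZMod 2), (n + n' - (n - n') % 2) / 2, (n - n') / 2), ?_⟩
    simp only [h, Prod.mk.injEq]
    omega

/-- The substitution `n = p + r + ε`, `n' = p - r`. -/
def sumDiffEquiv :
    (Fin 2 → ZMod 2) × (ℤ × ℤ) × (ℤ × ℤ) ≃ (ℤ × ℤ) × (ℤ × ℤ) :=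
  Equiv.ofBijective (fun t => (t.2.1 + t.2.2 + intLift t.1, t.2.1 - t.2.2)) <| by
    obtain ⟨hi, hs⟩ := bijective_sum_diff
    constructor
    · rintro ⟨e, ⟨p1, p2⟩, ⟨r1, r2⟩⟩ ⟨e', ⟨p1', p2'⟩, ⟨r1', r2'⟩⟩ h
      simp only [intLift, Prod.mk.injEq, Prod.mk_add_mk, Prod.mk_sub_mk] at h
      obtain ⟨⟨h1, h2⟩, h3, h4⟩ := h
      have A := @hi (e 0, p1, r1) (e' 0, p1', r1') (Prod.ext h1 h3)
      have B := @hi (e 1, p2, r2) (e' 1, p2', r2') (Prod.ext h2 h4)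
      simp only [Prod.mk.injEq] at A B
      have : e = e' := by ext i; fin_cases i <;> simp [A.1, B.1]
      simp [this, A, B]
    · rintro ⟨⟨n1, n2⟩, ⟨m1, m2⟩⟩
      obtain ⟨⟨e, p, r⟩, h⟩ := hs (n1, m1)
      obtain ⟨⟨e', p', r'⟩, h'⟩ := hs (n2, m2)
      refine ⟨(![e, e'], (p, p'), (r, r')), ?_⟩
      simp only [Prod.mk.injEq] at h h'
      simp [intLift, h, h', -ZMod.natCast_val]

/-- The parallelogram identity Q(x) + Q(y) = 2Q((x+y)/2) + 2Q((x−y)/2), applied to the exponents of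
the double series after `sumDiffEquiv`. -/
lemma thetaInt_mul (a b β : ℤ × ℤ) {P : SymCoord} (hP : P ∈ siegelCoord) (z : ℂ × ℂ) :
    thetaInt a b P z * thetaInt a (b + β) P z =
      ∑ ε : Fin 2 → ZMod 2, thetaInt (a + intLift ε) (2 • b + β) ((2 : ℂ) • P) ((2 : ℂ) • z) *
        thetaInt (intLift ε) (-β) ((2 : ℂ) • P) 0 := by
  have h2P : (2 : ℂ) • P ∈ siegelCoord := by
    simpa using smul_mem_siegelCoord hP (t := 2) two_pos
  have s (a b : ℤ × ℤ) (z : ℂ × ℂ) {P : SymCoord} (hP : P ∈ siegelCoord) :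
      Summable fun n => ‖wterm a (thetaWeight a b z) P n‖ :=
    (expGrowth_thetaWeight a b z).summable_norm hP
  unfold thetaInt
  rw [tsum_mul_tsum_of_summable_norm (s a b z hP) (s a (b + β) z hP), ← sumDiffEquiv.tsum_eq,
    Summable.tsum_prod, tsum_fintype]
  · refine Finset.sum_congr rfl fun ε _ => ?_
    rw [tsum_mul_tsum_of_summable_norm (s _ _ _ h2P) (s _ _ _ h2P)]
    refine tsum_congr fun pr => ?_
    obtain ⟨⟨p1, p2⟩, ⟨r1, r2⟩⟩ := pr
    simp only [wterm_thetaWeight, ← Complex.exp_add]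
    congr 1
    simp only [sumDiffEquiv, Equiv.ofBijective_apply, quadForm, cpt, shiftPt, thetaLin, intLift,
      Prod.smul_fst, Prod.smul_snd, smul_eq_mul, Prod.fst_add, Prod.snd_add, Prod.fst_sub,
      Prod.snd_sub, Prod.fst_neg, Prod.snd_neg, Prod.fst_zero, Prod.snd_zero, two_nsmul]
    push_cast
    ring
  · exact (sumDiffEquiv.summable_iff (f := fun x : (ℤ × ℤ) × (ℤ × ℤ) =>
      wterm a (thetaWeight a b z) P x.1 * wterm a (thetaWeight a (b + β) z) P x.2)).mpr
      (summable_mul_of_summable_norm (s a b z hP) (s a (b + β) z hP))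

/-! ### Characteristics modulo 2. -/

/-- The nontrivial character of `ℤ/2`. -/
def sgn (x : ZMod 2) : ℂ := if x = 0 then 1 else -1

lemma sgn_add (x y : ZMod 2) : sgn (x + y) = sgn x * sgn y := by
  have h : ∀ x : ZMod 2, x = 0 ∨ x = 1 := by decide
  have h11 : (1 : ZMod 2) + 1 = 0 := by decide
  rcases h x with rfl | rfl <;> rcases h y with rfl | rfl <;> simp [sgn, h11]

lemma sgn_mul_self (x : ZMod 2) : sgn x * sgn x = 1 := by
  unfold sgn; split_ifs <;> simp

@[simp] lemma sgn_zero : sgn 0 = 1 := by simp [sgn]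

@[simp] lemma sgn_one : sgn 1 = -1 := by simp [sgn]

lemma sgn_eq_or (x : ZMod 2) : sgn x = 1 ∨ sgn x = -1 := by
  unfold sgn; split_ifs <;> simp

lemma exp_pi_mul_I_int (k : ℤ) : Complex.exp (Real.pi * Complex.I * k) = sgn (k : ZMod 2) := by
  rcases Int.even_or_odd' k with ⟨j, rfl | rfl⟩
  · have : ((2 * j : ℤ) : ZMod 2) = 0 := by
      push_cast; rw [show (2 : ZMod 2) = 0 from rfl]; simp
    rw [this, sgn_zero, Complex.exp_eq_one_iff]
    exact ⟨j, by push_cast; ring⟩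
  · have : ((2 * j + 1 : ℤ) : ZMod 2) = 1 := by
      push_cast; rw [show (2 : ZMod 2) = 0 from rfl]; simp
    rw [this, sgn_one]
    have e : (Real.pi * Complex.I * ((2 * j + 1 : ℤ) : ℂ) : ℂ) =
        Real.pi * Complex.I + j * (2 * Real.pi * Complex.I) := by push_cast; ring
    rw [e, Complex.exp_add, Complex.exp_pi_mul_I, Complex.exp_int_mul_two_pi_mul_I, mul_one]

lemma thetaInt_add_left (a k b : ℤ × ℤ) (P : SymCoord) (z : ℂ × ℂ) :
    thetaInt (a + 2 • k) b P z = thetaInt a b P z := by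
  unfold thetaInt
  rw [← (Equiv.addRight k).tsum_eq (fun n => wterm a (thetaWeight a b z) P n)]
  refine tsum_congr fun n => ?_
  have : shiftPt (a + 2 • k) n = shiftPt a (n + k) := by
    ext <;> simp [shiftPt] <;> ring
  simp only [Equiv.coe_addRight, wterm, thetaWeight, thetaLin, this]

lemma thetaInt_add_right (a b k : ℤ × ℤ) (P : SymCoord) (z : ℂ × ℂ) :
    thetaInt a (b + 2 • k) P z =
      sgn ((a.1 * k.1 + a.2 * k.2 : ℤ) : ZMod 2) * thetaInt a b P z := by
  unfold thetaInt
  rw [← tsum_mul_left]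
  refine tsum_congr fun n => ?_
  have e : ((a.1 * k.1 + a.2 * k.2 : ℤ) : ZMod 2) =
      (((2 * n.1 + a.1) * k.1 + (2 * n.2 + a.2) * k.2 : ℤ) : ZMod 2) := by
    push_cast; rw [show (2 : ZMod 2) = 0 from rfl]; simp
  rw [e, ← exp_pi_mul_I_int, wterm_thetaWeight, wterm_thetaWeight, ← Complex.exp_add]
  congr 1
  simp only [thetaLin, shiftPt, Prod.fst_add, Prod.snd_add, two_nsmul]
  push_cast
  ring

lemma thetaInt_neg (a b : ℤ × ℤ) (P : SymCoord) (z : ℂ × ℂ) :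
    thetaInt a b P (-z) = thetaInt (-a) (-b) P z := by
  unfold thetaInt
  rw [← (Equiv.neg (ℤ × ℤ)).tsum_eq]
  refine tsum_congr fun n => ?_
  rw [wterm_thetaWeight, wterm_thetaWeight]
  congr 1
  simp only [thetaLin, shiftPt, quadForm, cpt, Equiv.neg_apply, Prod.fst_neg, Prod.snd_neg]
  push_cast
  ring

/-- The theta function of a characteristic mod `2`, in the coordinates `(τ₁₁, τ₁₂, τ₂₂)`. -/
def theta (m : Characteristic 2) (P : SymCoord) (z : ℂ × ℂ) : ℂ :=
  thetaInt (intLift m.1) (intLift m.2) P z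

/-- The reduction mod `2`. -/
def intRed (a : ℤ × ℤ) : Fin 2 → ZMod 2 := ![a.1, a.2]

lemma exists_intLift_intRed (a : ℤ × ℤ) : ∃ k : ℤ × ℤ, a = intLift (intRed a) + 2 • k := by
  refine ⟨(a.1 / 2, a.2 / 2), ?_⟩
  have h (x : ℤ) : ((((x : ℤ) : ZMod 2)).val : ℤ) = x % 2 := by
    rw [ZMod.val_intCast]; rfl
  ext <;> simp [intLift, intRed, h, -ZMod.natCast_val] <;> omega

lemma intRed_intLift (v : Fin 2 → ZMod 2) : intRed (intLift v) = v := by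
  ext i; fin_cases i <;> simp [intLift, intRed]

lemma intRed_add (a b : ℤ × ℤ) : intRed (a + b) = intRed a + intRed b := by
  ext i; fin_cases i <;> simp [intRed]

lemma intRed_two_smul (a : ℤ × ℤ) : intRed (2 • a) = 0 := by
  have h (x : ZMod 2) : 2 * x = 0 := by rw [show (2 : ZMod 2) = 0 from rfl, zero_mul]
  ext i; fin_cases i <;> simp [intRed, h]

lemma cast_dot_eq (a k : ℤ × ℤ) :
    ((a.1 * k.1 + a.2 * k.2 : ℤ) : ZMod 2) = intRed a ⬝ᵥ intRed k := by
  simp [intRed, dotProduct, Fin.sum_univ_two]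

/-- Changing the first half by an even vector reindexes the series; changing the second half
multiplies every term by the same sign. -/
lemma thetaInt_eq_theta (a b : ℤ × ℤ) (v : Fin 2 → ZMod 2) (k : ℤ × ℤ)
    (hk : b = intLift v + 2 • k) (P : SymCoord) (z : ℂ × ℂ) :
    thetaInt a b P z = sgn (intRed a ⬝ᵥ intRed k) * theta (intRed a, v) P z := by
  obtain ⟨l, hl⟩ := exists_intLift_intRed a
  rw [hk, thetaInt_add_right, cast_dot_eq]
  conv_lhs => rw [hl, thetaInt_add_left]
  rw [← hl, theta]

lemma theta_neg (m : Characteristic 2) (P : SymCoord) (z : ℂ × ℂ) :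
    theta m P (-z) = sgn (m.1 ⬝ᵥ m.2) * theta m P z := by
  have e (v : Fin 2 → ZMod 2) : -intLift v = intLift v + 2 • (-intLift v) := by
    rw [two_nsmul]; abel
  have r (v : Fin 2 → ZMod 2) : intRed (-intLift v) = v := by
    rw [e, intRed_add, intRed_two_smul, intRed_intLift, add_zero]
  rw [theta, thetaInt_neg, thetaInt_eq_theta _ _ m.2 _ (e m.2), r, r]

/-- The sign absorbs the choice of integral representatives. It is independent of P and z, so the
identity can be differentiated in z and compared across P. -/
lemma theta_mul (a b β : Fin 2 → ZMod 2) : ∃ s : ℂ, (s = 1 ∨ s = -1) ∧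
    ∀ P ∈ siegelCoord, ∀ z, theta (a, b) P z * theta (a, b + β) P z =
      s * ∑ ε : Fin 2 → ZMod 2, sgn (ε ⬝ᵥ (b + β)) *
        (theta (a + ε, β) ((2 : ℂ) • P) ((2 : ℂ) • z) * theta (ε, β) ((2 : ℂ) • P) 0) := by
  obtain ⟨k, hk⟩ := exists_intLift_intRed (intLift b + intLift β)
  rw [intRed_add, intRed_intLift, intRed_intLift] at hk
  refine ⟨sgn (a ⬝ᵥ intRed k + a ⬝ᵥ b), sgn_eq_or _, fun P hP z => ?_⟩
  have h := thetaInt_mul (intLift a) (intLift b) (intLift β) hP z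
  have e : -intLift β = intLift β + 2 • (-intLift β) := by rw [two_nsmul]; abel
  have r : intRed (-intLift β) = β := by
    rw [e, intRed_add, intRed_two_smul, intRed_intLift, add_zero]
  rw [thetaInt_eq_theta _ _ _ _ hk, intRed_intLift] at h
  have h2 (ε : Fin 2 → ZMod 2) (Q : SymCoord) :
      thetaInt (intLift a + intLift ε) (2 • intLift b + intLift β) Q ((2 : ℂ) • z) *
        thetaInt (intLift ε) (-intLift β) Q 0 =
      sgn (a ⬝ᵥ b) * (sgn (ε ⬝ᵥ (b + β)) *
        (theta (a + ε, β) Q ((2 : ℂ) • z) * theta (ε, β) Q 0)) := by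
    rw [thetaInt_eq_theta _ _ _ _ (add_comm (2 • intLift b) (intLift β)),
      thetaInt_eq_theta _ _ _ _ e, r, intRed_add, intRed_intLift, intRed_intLift, intRed_intLift,
      add_dotProduct, dotProduct_add, sgn_add, sgn_add]
    ring
  simp only [h2, ← Finset.mul_sum] at h
  rw [sgn_add, mul_assoc, ← h, theta, mul_left_comm, ← mul_assoc (sgn _) (sgn _), sgn_mul_self,
    one_mul]

/-! ### Gradients at z = 0. -/

/-- The derivative of the theta function at `z = 0` in the direction `d`. -/
def thetaGrad (m : Characteristic 2) (P : SymCoord) (d : ℂ × ℂ) : ℂ :=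
  deriv (fun t : ℂ => theta m P (t • d)) 0

/-- The weights of the differentiated theta series. -/
def gradWeight (a b : ℤ × ℤ) (d : ℂ × ℂ) (n : ℤ × ℤ) : ℂ :=
  2 * Real.pi * Complex.I * ((shiftPt a n).1 * d.1 + (shiftPt a n).2 * d.2) * thetaWeight a b 0 n

lemma expGrowth_gradWeight (a b : ℤ × ℤ) (d : ℂ × ℂ) : ExpGrowth a (gradWeight a b d) := by
  refine ⟨1, 2 * Real.pi * (‖d.1‖ + ‖d.2‖), by positivity, fun n => ?_⟩
  have h := norm_thetaWeight_le a b 0 n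
  simp only [Prod.fst_zero, Prod.snd_zero, norm_zero, add_zero, mul_zero, zero_mul,
    Real.exp_zero] at h
  unfold gradWeight
  set x := shiftPt a n
  rw [norm_mul, norm_mul]
  have h1 : ‖(2 * Real.pi * Complex.I : ℂ)‖ = 2 * Real.pi := by
    simp [abs_of_pos Real.pi_pos]
  have h2 : ‖(x.1 * d.1 + x.2 * d.2 : ℂ)‖ ≤ (‖d.1‖ + ‖d.2‖) * (|x.1| + |x.2|) := by
    refine (norm_add_le _ _).trans ?_
    rw [norm_mul, norm_mul, Complex.norm_real, Complex.norm_real, Real.norm_eq_abs,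
      Real.norm_eq_abs]
    nlinarith [mul_nonneg (abs_nonneg x.1) (norm_nonneg d.2),
      mul_nonneg (abs_nonneg x.2) (norm_nonneg d.1)]
  have h3 : |x.1| + |x.2| ≤ Real.exp (1 * (|x.1| + |x.2|)) := by
    rw [one_mul]
    linarith [Real.add_one_le_exp (|x.1| + |x.2|)]
  rw [h1]
  calc 2 * Real.pi * ‖(x.1 * d.1 + x.2 * d.2 : ℂ)‖ * ‖thetaWeight a b 0 n‖
      ≤ 2 * Real.pi * ((‖d.1‖ + ‖d.2‖) * Real.exp (1 * (|x.1| + |x.2|))) * 1 := by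
        gcongr
        exact h2.trans (by gcongr)
    _ = _ := by ring

lemma hasDerivAt_wterm (a b : ℤ × ℤ) (P : SymCoord) (d : ℂ × ℂ) (n : ℤ × ℤ) (t : ℂ) :
    HasDerivAt (fun t : ℂ => wterm a (thetaWeight a b (t • d)) P n)
      (2 * Real.pi * Complex.I * ((shiftPt a n).1 * d.1 + (shiftPt a n).2 * d.2) *
        wterm a (thetaWeight a b (t • d)) P n) t := by
  simp only [wterm_thetaWeight]
  have h : HasDerivAt (fun t : ℂ => Real.pi * Complex.I *
      (quadForm P (cpt (shiftPt a n)) + 2 * thetaLin a b n (t • d)))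
      (2 * Real.pi * Complex.I * ((shiftPt a n).1 * d.1 + (shiftPt a n).2 * d.2)) t := by
    have e : (fun t : ℂ => Real.pi * Complex.I *
      (quadForm P (cpt (shiftPt a n)) + 2 * thetaLin a b n (t • d))) = fun t : ℂ =>
        (2 * Real.pi * Complex.I * ((shiftPt a n).1 * d.1 + (shiftPt a n).2 * d.2)) * t +
        Real.pi * Complex.I * (quadForm P (cpt (shiftPt a n)) + 2 * thetaLin a b n 0) := by
      ext t
      simp only [thetaLin, Prod.smul_fst, Prod.smul_snd, smul_eq_mul, Prod.fst_zero, Prod.snd_zero]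
      ring
    rw [e]
    simpa using ((hasDerivAt_id t).const_mul
      (2 * Real.pi * Complex.I * ((shiftPt a n).1 * d.1 + (shiftPt a n).2 * d.2) : ℂ)).add_const
      (Real.pi * Complex.I * (quadForm P (cpt (shiftPt a n)) + 2 * thetaLin a b n 0))
  have := h.cexp
  rwa [mul_comm (Complex.exp _)] at this

lemma exists_summable_bound_ball (a b : ℤ × ℤ) {P : SymCoord} (hP : P ∈ siegelCoord) (d : ℂ × ℂ) :
    ∃ u : ℤ × ℤ → ℝ, Summable u ∧ ∀ n, ∀ t ∈ Metric.ball (0 : ℂ) 1,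
      ‖wterm a (thetaWeight a b (t • d)) P n‖ ≤ u n := by
  obtain ⟨K, hK, h⟩ := exp_form_le a (imBound_pos hP) (2 * Real.pi * (‖d.1‖ + ‖d.2‖))
  refine ⟨fun n => K * expMajorant n, summable_expMajorant.mul_left _, fun n t ht => ?_⟩
  refine le_trans ?_ (h P (imBound_le hP) n)
  rw [wterm, norm_mul, norm_exp_quadForm]
  refine mul_le_mul_of_nonneg_right ((norm_thetaWeight_le a b _ n).trans ?_) (Real.exp_pos _).le
  rw [Real.exp_le_exp]
  have ht' : ‖t‖ ≤ 1 := by simpa using (mem_ball_zero_iff.mp ht).le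
  have : ‖(t • d).1‖ + ‖(t • d).2‖ ≤ ‖d.1‖ + ‖d.2‖ := by
    simp only [Prod.smul_fst, Prod.smul_snd, smul_eq_mul, norm_mul]
    nlinarith [norm_nonneg d.1, norm_nonneg d.2]
  gcongr

lemma differentiableAt_theta (m : Characteristic 2) {P : SymCoord} (hP : P ∈ siegelCoord)
    (d : ℂ × ℂ) : DifferentiableAt ℂ (fun t : ℂ => theta m P (t • d)) 0 := by
  obtain ⟨u, hu, h⟩ := exists_summable_bound_ball (intLift m.1) (intLift m.2) hP d
  exact (Complex.differentiableOn_tsum_of_summable_norm hu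
    (fun n t _ => (hasDerivAt_wterm _ _ P d n t).differentiableAt.differentiableWithinAt)
    Metric.isOpen_ball h).differentiableAt (Metric.ball_mem_nhds _ one_pos)

/-- Termwise differentiation exhibits the gradient as a weighted theta series, which yields its
holomorphy in P. -/
lemma thetaGrad_eq_tsum (m : Characteristic 2) {P : SymCoord} (hP : P ∈ siegelCoord)
    (d : ℂ × ℂ) : thetaGrad m P d =
      ∑' n, wterm (intLift m.1) (gradWeight (intLift m.1) (intLift m.2) d) P n := by
  obtain ⟨u, hu, h⟩ := exists_summable_bound_ball (intLift m.1) (intLift m.2) hP d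
  have := Complex.hasSum_deriv_of_summable_norm hu
    (fun n t _ => (hasDerivAt_wterm _ _ P d n t).differentiableAt.differentiableWithinAt)
    Metric.isOpen_ball h (Metric.mem_ball_self one_pos)
  rw [thetaGrad]
  unfold theta thetaInt
  rw [← this.tsum_eq]
  refine tsum_congr fun n => ?_
  rw [(hasDerivAt_wterm _ _ P d n 0).deriv, zero_smul, wterm, wterm, gradWeight]
  ring

lemma lineHolo_theta (m : Characteristic 2) : LineHolo fun P => theta m P 0 :=
  (expGrowth_thetaWeight _ _ _).lineHolo

lemma lineHolo_thetaGrad (m : Characteristic 2) (d : ℂ × ℂ) :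
    LineHolo fun P => thetaGrad m P d := by
  intro P V
  exact ((expGrowth_gradWeight _ _ d).lineHolo P V).congr fun w hw => thetaGrad_eq_tsum m hw d

lemma theta_zero_of_odd {m : Characteristic 2} (hm : m.1 ⬝ᵥ m.2 = 1) (P : SymCoord) :
    theta m P 0 = 0 := by
  have := theta_neg m P 0
  rw [hm, sgn_one, neg_zero] at this
  exact self_eq_neg.mp (by linear_combination this)

/-- Differentiate `theta_mul` at z = 0. The odd factor vanishes there, so only one term of the
product rule survives; the factor 2 is the derivative of z ↦ 2z. -/
lemma thetaGrad_mul_theta (a b β : Fin 2 → ZMod 2) (hab : a ⬝ᵥ b = 1) : ∃ s : ℂ,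
    (s = 1 ∨ s = -1) ∧
    ∀ P ∈ siegelCoord, ∀ d, thetaGrad (a, b) P d * theta (a, b + β) P 0 =
      s * ∑ ε : Fin 2 → ZMod 2, sgn (ε ⬝ᵥ (b + β)) *
        (2 * thetaGrad (a + ε, β) ((2 : ℂ) • P) d * theta (ε, β) ((2 : ℂ) • P) 0) := by
  obtain ⟨s, hs, h⟩ := theta_mul a b β
  refine ⟨s, hs, fun P hP d => ?_⟩
  have h2P : (2 : ℂ) • P ∈ siegelCoord := by
    simpa using smul_mem_siegelCoord hP (t := 2) two_pos
  have hl : HasDerivAt (fun t : ℂ => theta (a, b) P (t • d) * theta (a, b + β) P (t • d))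
      (thetaGrad (a, b) P d * theta (a, b + β) P 0) 0 := by
    have := (differentiableAt_theta (a, b) hP d).hasDerivAt.mul
      (differentiableAt_theta (a, b + β) hP d).hasDerivAt
    rw [zero_smul, theta_zero_of_odd (m := (a, b)) hab, zero_mul, add_zero] at this
    exact this
  have hr : HasDerivAt (fun t : ℂ => s * ∑ ε : Fin 2 → ZMod 2, sgn (ε ⬝ᵥ (b + β)) *
        (theta (a + ε, β) ((2 : ℂ) • P) ((2 : ℂ) • t • d) * theta (ε, β) ((2 : ℂ) • P) 0))
      (s * ∑ ε : Fin 2 → ZMod 2, sgn (ε ⬝ᵥ (b + β)) *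
        (2 * thetaGrad (a + ε, β) ((2 : ℂ) • P) d * theta (ε, β) ((2 : ℂ) • P) 0)) 0 := by
    refine HasDerivAt.const_mul _ (HasDerivAt.fun_sum fun ε _ => HasDerivAt.const_mul _
      (HasDerivAt.mul_const ?_ _))
    have := (differentiableAt_theta (a + ε, β) h2P d).hasDerivAt
    have h0 : HasDerivAt (fun t : ℂ => 2 * t) 2 0 := by
      simpa using (hasDerivAt_id (0 : ℂ)).const_mul 2
    have h3 := HasDerivAt.comp_of_eq (0 : ℂ) this h0 (mul_zero 2).symm
    rw [mul_comm] at h3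
    simpa [thetaGrad, Function.comp_def, smul_smul] using h3
  have e : (fun t : ℂ => theta (a, b) P (t • d) * theta (a, b + β) P (t • d)) = _ :=
    funext fun t => h P hP (t • d)
  rw [e] at hl
  exact hl.unique hr

/-! ### Leading terms along the rays 2^k P. -/

/-- The matrices whose imaginary part has an obtuse superbase `e₁, e₂, -e₁-e₂`. -/
def obtuseCoord : Set SymCoord :=
  {P | P.2.1.im < 0 ∧ 0 < P.1.im + P.2.1.im ∧ 0 < P.2.2.im + P.2.1.im}

lemma obtuseCoord_subset : obtuseCoord ⊆ siegelCoord := by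
  rintro P ⟨h1, h2, h3⟩
  exact ⟨by linarith, by nlinarith⟩

lemma isOpen_obtuseCoord : IsOpen obtuseCoord := by
  have h1 : Continuous fun P : SymCoord => P.1.im := Complex.continuous_im.comp continuous_fst
  have h2 : Continuous fun P : SymCoord => P.2.1.im :=
    Complex.continuous_im.comp (continuous_fst.comp continuous_snd)
  have h3 : Continuous fun P : SymCoord => P.2.2.im :=
    Complex.continuous_im.comp (continuous_snd.comp continuous_snd)
  exact (isOpen_lt h2 continuous_const).inter
    ((isOpen_lt continuous_const (h1.add h2)).inter (isOpen_lt continuous_const (h3.add h2)))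

lemma exists_mem_obtuseCoord : ∃ P, P ∈ obtuseCoord :=
  ⟨(2 * Complex.I, -Complex.I, 2 * Complex.I), by norm_num [obtuseCoord]⟩

/-- Selling's form: on `obtuseCoord` all three coefficients are positive, so the squares can be
minimised separately. -/
lemma imForm_eq (P : SymCoord) (x : ℝ × ℝ) : imForm P x =
    (P.1.im + P.2.1.im) * x.1 ^ 2 + (P.2.2.im + P.2.1.im) * x.2 ^ 2 +
      (-P.2.1.im) * (x.1 - x.2) ^ 2 := by
  unfold imForm; ring

lemma intLift_cases (v : Fin 2 → ZMod 2) :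
    ((intLift v).1 = 0 ∨ (intLift v).1 = 1) ∧ ((intLift v).2 = 0 ∨ (intLift v).2 = 1) := by
  have h0 := ZMod.val_lt (v 0)
  have h1 := ZMod.val_lt (v 1)
  simp only [intLift]
  omega

/-- The difference of the two sides is n(n + a), nonnegative because no integer lies strictly
between 0 and −a. -/
lemma sq_le_of_shift {a n : ℤ} (ha : a = 0 ∨ a = 1 ∨ a = -1) :
    ((a : ℝ) / 2) ^ 2 ≤ ((n : ℝ) + a / 2) ^ 2 := by
  have h : 0 ≤ n * (n + a) := by
    rcases le_or_gt n 0 with hn | hn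
    · rcases hn.eq_or_lt with rfl | hn
      · simp
      · exact mul_nonneg_of_nonpos_of_nonpos hn.le (by omega)
    · exact mul_nonneg hn.le (by omega)
  have h' : (0 : ℝ) ≤ n * (n + a) := by exact_mod_cast h
  nlinarith

/-- The three squares in `imForm_eq` are each minimal at n = 0. Equality in all three forces n₁, n₂
and n₁ − n₂ each to be 0 or minus the corresponding shift, which leaves only n = 0 and n = −a. -/
lemma imForm_half_lt {P : SymCoord} (hP : P ∈ obtuseCoord) (v : Fin 2 → ZMod 2) {n : ℤ × ℤ}
    (hn : ¬(n = 0 ∨ n = -intLift v)) :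
    imForm P (shiftPt (intLift v) 0) < imForm P (shiftPt (intLift v) n) := by
  obtain ⟨h1, h2, h3⟩ := hP
  obtain ⟨c1, c2⟩ := intLift_cases v
  set a := intLift v
  have i1 := sq_le_of_shift (a := a.1) (n := n.1) (by tauto)
  have i2 := sq_le_of_shift (a := a.2) (n := n.2) (by tauto)
  have i3 := sq_le_of_shift (a := a.1 - a.2) (n := n.1 - n.2) (by omega)
  rw [imForm_eq, imForm_eq]
  simp only [shiftPt, Prod.fst_zero, Prod.snd_zero, Int.cast_zero, zero_add]
  have e3 : ((n.1 : ℝ) + a.1 / 2 - (n.2 + a.2 / 2)) ^ 2 =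
    (((n.1 - n.2 : ℤ) : ℝ) + ((a.1 - a.2 : ℤ) : ℝ) / 2) ^ 2 := by push_cast; ring
  have e4 : ((a.1 / 2 - a.2 / 2 : ℝ)) ^ 2 = (((a.1 - a.2 : ℤ) : ℝ) / 2) ^ 2 := by
    push_cast; ring
  rw [e3, e4]
  by_contra hcon
  push Not at hcon
  have m1 := mul_le_mul_of_nonneg_left i1 h2.le
  have m2 := mul_le_mul_of_nonneg_left i2 h3.le
  have m3 := mul_le_mul_of_nonneg_left i3 (neg_pos.mpr h1).le
  have q1 := mul_left_cancel₀ h2.ne' (le_antisymm m1 (by linarith))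
  have q2 := mul_left_cancel₀ h3.ne' (le_antisymm m2 (by linarith))
  have q3 := mul_left_cancel₀ (neg_pos.mpr h1).ne' (le_antisymm m3 (by linarith))
  have r1 : n.1 * (n.1 + a.1) = 0 := by
    have : (n.1 : ℝ) * (n.1 + a.1) = 0 := by linarith
    exact_mod_cast this
  have r2 : n.2 * (n.2 + a.2) = 0 := by
    have : (n.2 : ℝ) * (n.2 + a.2) = 0 := by linarith
    exact_mod_cast this
  have r3 : (n.1 - n.2) * ((n.1 - n.2) + (a.1 - a.2)) = 0 := by
    have : ((n.1 - n.2 : ℤ) : ℝ) * (((n.1 - n.2 : ℤ) : ℝ) + ((a.1 - a.2 : ℤ) : ℝ)) = 0 := by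
      linarith
    exact_mod_cast this
  apply hn
  rw [mul_eq_zero] at r1 r2 r3
  rw [Prod.ext_iff, Prod.ext_iff]
  simp only [Prod.fst_zero, Prod.snd_zero, Prod.fst_neg, Prod.snd_neg]
  omega

lemma quadForm_neg_shift (P : SymCoord) (a : ℤ × ℤ) :
    quadForm P (cpt (shiftPt a (-a))) = quadForm P (cpt (shiftPt a 0)) := by
  simp only [quadForm, cpt, shiftPt, Prod.fst_neg, Prod.snd_neg, Prod.fst_zero, Prod.snd_zero]
  push_cast
  ring

/-- Leading behaviour of a weighted theta series along the ray `2 ^ k P`. -/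
lemma tendsto_wterm_tsum {P : SymCoord} (hP : P ∈ obtuseCoord) (v : Fin 2 → ZMod 2)
    {W : ℤ × ℤ → ℂ} (hW : ExpGrowth (intLift v) W) :
    Tendsto (fun k : ℕ =>
      Complex.exp (-(Real.pi * Complex.I * quadForm P (cpt (shiftPt (intLift v) 0)))) ^ (2 ^ k) *
        ∑' n, wterm (intLift v) W ((2 : ℂ) ^ k • P) n) atTop
      (𝓝 (∑' n, if n = 0 ∨ n = -intLift v then W n else 0)) := by
  classical
  set a := intLift v
  set c : ℤ × ℤ → ℂ := fun n => Complex.exp (Real.pi * Complex.I *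
    (quadForm P (cpt (shiftPt a n)) - quadForm P (cpt (shiftPt a 0)))) with hc
  have hnorm (n : ℤ × ℤ) : ‖c n‖ =
      Real.exp (-Real.pi * (imForm P (shiftPt a n) - imForm P (shiftPt a 0))) := by
    simp only [hc]
    rw [Complex.norm_exp, ← im_quadForm, ← im_quadForm]
    simp
  have hc1 (n : ℤ × ℤ) (hn : n = 0 ∨ n = -a) : c n = 1 := by
    rcases hn with rfl | rfl
    · simp [hc]
    · simp [hc, quadForm_neg_shift]
  have hclt (n : ℤ × ℤ) (hn : ¬(n = 0 ∨ n = -a)) : ‖c n‖ < 1 := by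
    rw [hnorm, Real.exp_lt_one_iff]
    have := imForm_half_lt hP v hn
    nlinarith [Real.pi_pos]
  have hcle (n : ℤ × ℤ) : ‖c n‖ ≤ 1 := by
    by_cases hn : n = 0 ∨ n = -a
    · simp [hc1 n hn]
    · exact (hclt n hn).le
  have hterm (k : ℕ) (n : ℤ × ℤ) :
      Complex.exp (-(Real.pi * Complex.I * quadForm P (cpt (shiftPt a 0)))) ^ (2 ^ k) *
        wterm a W ((2 : ℂ) ^ k • P) n = W n * c n ^ (2 ^ k) := by
    have : quadForm ((2 : ℂ) ^ k • P) (cpt (shiftPt a n)) =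
        (2 ^ k : ℕ) * quadForm P (cpt (shiftPt a n)) := by
      simp only [quadForm, Prod.smul_fst, Prod.smul_snd, smul_eq_mul]
      push_cast
      ring
    rw [wterm, this, mul_left_comm, ← Complex.exp_nat_mul, ← Complex.exp_add, hc,
      ← Complex.exp_nat_mul]
    congr 2
    ring
  simp_rw [← tsum_mul_left, hterm]
  -- All ratios c n have modulus at most 1, so the normalised series at P itself dominates the ones
  -- at 2^k P.
  refine tendsto_tsum_of_dominated_convergence (bound := fun n =>
    Real.exp (Real.pi * imForm P (shiftPt a 0)) * ‖wterm a W P n‖)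
    ((hW.summable_norm (obtuseCoord_subset hP)).mul_left _) (fun n => ?_)
    (Eventually.of_forall fun k n => ?_)
  · by_cases hn : n = 0 ∨ n = -a
    · simp [hn, hc1 n hn]
    · simp only [hn, if_false]
      rw [← mul_zero (W n)]
      exact ((tendsto_pow_atTop_nhds_zero_of_norm_lt_one (hclt n hn)).comp
        (tendsto_pow_atTop_atTop_of_one_lt one_lt_two)).const_mul _
  · have h1 : ‖c n ^ (2 ^ k)‖ ≤ ‖c n‖ := by
      rw [norm_pow]
      exact pow_le_of_le_one (norm_nonneg _) (hcle n) (by positivity)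
    calc ‖W n * c n ^ (2 ^ k)‖ ≤ ‖W n‖ * ‖c n‖ := by rw [norm_mul]; gcongr
      _ = _ := by
        rw [hnorm, wterm, norm_mul, norm_exp_quadForm, mul_left_comm, ← Real.exp_add]
        congr 2
        ring

lemma tsum_ite_zero_neg {a : ℤ × ℤ} (W : ℤ × ℤ → ℂ) :
    (∑' n, if n = 0 ∨ n = -a then W n else 0) = if a = 0 then W 0 else W 0 + W (-a) := by
  classical
  rw [tsum_eq_sum (s := {0, -a})]
  · split_ifs with h
    · simp [h]
    · rw [Finset.sum_pair]
      · simp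
      · intro h'
        exact h (neg_eq_zero.mp h'.symm)
  · intro n hn
    simp only [Finset.mem_insert, Finset.mem_singleton] at hn
    simp [hn]

/-- The normalising factor of the theta series with characteristic `m` along the ray `2 ^ k P`. -/
def leadFactor (v : Fin 2 → ZMod 2) (P : SymCoord) : ℂ :=
  Complex.exp (-(Real.pi * Complex.I * quadForm P (cpt (shiftPt (intLift v) 0))))

lemma intLift_eq_zero_iff {v : Fin 2 → ZMod 2} : intLift v = 0 ↔ v = 0 := by
  constructor
  · intro h
    have := intRed_intLift v
    rw [h] at this
    rw [← this]
    ext i; fin_cases i <;> simp [intRed]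
  · rintro rfl
    simp [intLift]

lemma thetaWeight_zero_zero (a b : ℤ × ℤ) : thetaWeight a b 0 0 =
    Complex.exp (Real.pi * Complex.I * ((a.1 * b.1 + a.2 * b.2 : ℤ) / 2)) := by
  simp only [thetaWeight, thetaLin, shiftPt, Prod.fst_zero, Prod.snd_zero]
  congr 1
  push_cast
  ring

lemma thetaWeight_zero_neg (a b : ℤ × ℤ) : thetaWeight a b 0 (-a) =
    Complex.exp (-(Real.pi * Complex.I * ((a.1 * b.1 + a.2 * b.2 : ℤ) / 2))) := by
  simp only [thetaWeight, thetaLin, shiftPt, Prod.fst_zero, Prod.snd_zero, Prod.fst_neg,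
    Prod.snd_neg]
  congr 1
  push_cast
  ring

lemma intLift_dot (m : Characteristic 2) :
    (((intLift m.1).1 * (intLift m.2).1 + (intLift m.1).2 * (intLift m.2).2 : ℤ) : ZMod 2) =
      m.1 ⬝ᵥ m.2 := by
  rw [cast_dot_eq, intRed_intLift, intRed_intLift]

/-- The minimal terms n = 0 and n = −a have equal weights for an even characteristic, and are one
and the same term when a = 0; hence the factor 1 or 2. -/
lemma tendsto_theta {m : Characteristic 2} (hm : m.1 ⬝ᵥ m.2 = 0) :
    ∃ l : ℂ, (l = 1 ∨ l = -1) ∧ ∀ P ∈ obtuseCoord,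
      Tendsto (fun k : ℕ => leadFactor m.1 P ^ (2 ^ k) * theta m ((2 : ℂ) ^ k • P) 0) atTop
        (𝓝 ((if m.1 = 0 then 1 else 2) * l)) := by
  have hN := intLift_dot m
  rw [hm] at hN
  set a := intLift m.1 with ha
  set b := intLift m.2
  set N := a.1 * b.1 + a.2 * b.2
  obtain ⟨j, hj⟩ := (ZMod.intCast_zmod_eq_zero_iff_dvd N 2).mp hN |>.imp fun j hj => hj
  push_cast at hj
  have hNj : ((N : ℤ) : ℂ) / 2 = j := by rw [hj]; push_cast; ring
  have h0 : thetaWeight a b 0 0 = sgn (j : ZMod 2) := by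
    rw [thetaWeight_zero_zero, hNj, exp_pi_mul_I_int]
  have h1 : thetaWeight a b 0 (-a) = sgn (j : ZMod 2) := by
    rw [thetaWeight_zero_neg, hNj, Complex.exp_neg, exp_pi_mul_I_int]
    exact inv_eq_of_mul_eq_one_left (sgn_mul_self _)
  refine ⟨sgn (j : ZMod 2), sgn_eq_or _, fun P hP => ?_⟩
  have := tendsto_wterm_tsum hP m.1 (expGrowth_thetaWeight a b 0)
  rw [tsum_ite_zero_neg, h0, h1] at this
  have e : (if a = 0 then sgn (j : ZMod 2) else sgn (j : ZMod 2) + sgn (j : ZMod 2)) =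
      (if m.1 = 0 then 1 else 2) * sgn (j : ZMod 2) := by
    simp only [ha, intLift_eq_zero_iff]
    split_ifs <;> ring
  rw [e] at this
  exact this

/-- For an odd characteristic the exponential weights at n = 0 and n = −a are ±i with opposite
signs, and so are the linear forms; the two terms reinforce each other. -/
lemma tendsto_thetaGrad {m : Characteristic 2} (hm : m.1 ⬝ᵥ m.2 = 1) {P : SymCoord}
    (hP : P ∈ obtuseCoord) (d : ℂ × ℂ) :
    Tendsto (fun k : ℕ => leadFactor m.1 P ^ (2 ^ k) * thetaGrad m ((2 : ℂ) ^ k • P) d) atTop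
      (𝓝 (-(2 * Real.pi) * ((intLift m.1).1 * d.1 + (intLift m.1).2 * d.2) *
        sgn ((((intLift m.1).1 * (intLift m.2).1 + (intLift m.1).2 * (intLift m.2).2) / 2 : ℤ) :
          ZMod 2))) := by
  have hN := intLift_dot m
  rw [hm] at hN
  have ha0 : m.1 ≠ 0 := by rintro h; simp [h] at hm
  set a := intLift m.1 with ha
  set b := intLift m.2
  set N := a.1 * b.1 + a.2 * b.2
  have hodd : N = 2 * (N / 2) + 1 := by
    have : ¬ (2 : ℤ) ∣ N := by
      intro h
      have := (ZMod.intCast_zmod_eq_zero_iff_dvd N 2).mpr h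
      rw [this] at hN
      exact absurd hN (by decide)
    omega
  set j := N / 2
  have e : (Real.pi * Complex.I * ((N : ℤ) / 2) : ℂ) =
      Real.pi * Complex.I * j + Real.pi / 2 * Complex.I := by
    rw [hodd]; push_cast; ring
  have h0 : thetaWeight a b 0 0 = sgn (j : ZMod 2) * Complex.I := by
    rw [thetaWeight_zero_zero, e, Complex.exp_add, exp_pi_mul_I_int, Complex.exp_pi_div_two_mul_I]
  have h1 : thetaWeight a b 0 (-a) = -(sgn (j : ZMod 2) * Complex.I) := by
    rw [thetaWeight_zero_neg, Complex.exp_neg, e, Complex.exp_add, exp_pi_mul_I_int,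
      Complex.exp_pi_div_two_mul_I, mul_inv, Complex.inv_I,
      inv_eq_of_mul_eq_one_left (sgn_mul_self _), mul_neg]
  have := tendsto_wterm_tsum hP m.1 (expGrowth_gradWeight a b d)
  rw [tsum_ite_zero_neg, if_neg (by rw [intLift_eq_zero_iff]; exact ha0)] at this
  have hs (k : ℕ) : (2 : ℂ) ^ k • P ∈ siegelCoord := by
    simpa using smul_mem_siegelCoord (obtuseCoord_subset hP) (t := 2 ^ k) (by positivity)
  simp_rw [thetaGrad_eq_tsum m (hs _) d]
  refine Tendsto.congr (fun _ => rfl) ((congrArg (Tendsto _ _) (congrArg 𝓝 ?_)).mp this)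
  unfold gradWeight
  rw [← ha, h0, h1]
  simp only [shiftPt, Prod.fst_neg, Prod.snd_neg, Prod.fst_zero, Prod.snd_zero]
  push_cast
  linear_combination (2 * Real.pi * (a.1 * d.1 + a.2 * d.2) * sgn (j : ZMod 2)) * Complex.I_sq

lemma exists_theta_ne_zero {m : Characteristic 2} (hm : m.1 ⬝ᵥ m.2 = 0) :
    ∃ P ∈ siegelCoord, theta m P 0 ≠ 0 := by
  obtain ⟨l, hl, h⟩ := tendsto_theta hm
  obtain ⟨P, hP⟩ := exists_mem_obtuseCoord
  have hne : (if m.1 = 0 then 1 else 2) * l ≠ 0 := by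
    rcases hl with rfl | rfl <;> split_ifs <;> simp
  obtain ⟨k, hk⟩ := ((h P hP).eventually_ne hne).exists
  refine ⟨(2 : ℂ) ^ k • P, ?_, right_ne_zero_of_mul hk⟩
  simpa using smul_mem_siegelCoord (obtuseCoord_subset hP) (t := 2 ^ k) (by positivity)

/-! ### Linear algebra over ℤ/2 in the plane. -/

section Combinatorics

set_option maxRecDepth 20000
set_option synthInstance.maxHeartbeats 200000
set_option synthInstance.maxSize 2000

/-- The vector orthogonal to `v` over `ℤ/2`. -/
def perp (v : Fin 2 → ZMod 2) : Fin 2 → ZMod 2 := ![v 1, v 0]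

/-- The even characteristics `m` such that `m + s` is odd. -/
def fourPlet (s : Characteristic 2) : Finset (Characteristic 2) :=
  Finset.univ.filter fun m => m.1 ⬝ᵥ m.2 = 0 ∧ (m + s).1 ⬝ᵥ (m + s).2 = 1

/-- This and `fourPlet_of_eq` list the 4-plets in the shape in which the duplication formulas
produce the theta constants. -/
lemma fourPlet_of_ne : ∀ a b c d : Fin 2 → ZMod 2, a ⬝ᵥ b = 1 → c ⬝ᵥ d = 1 → a ≠ c →
    fourPlet ((a, b) + (c, d)) =
      {(0, b + d + perp a), (0, b + d + perp c), (a, b + perp c), (c, d + perp a)} := by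
  decide +kernel

lemma fourPlet_of_eq : ∀ a b d c : Fin 2 → ZMod 2, a ⬝ᵥ b = 1 → a ⬝ᵥ d = 1 → b ≠ d → c ≠ 0 →
    c ≠ a → fourPlet ((a, b) + (a, d)) =
      {(a + c, 0), (a + c, perp (a + c)), (c, 0), (c, perp c)} := by
  decide +kernel

lemma orthogonal_cases : ∀ g b e : Fin 2 → ZMod 2, g ≠ 0 → b ≠ 0 → g ⬝ᵥ b = 0 →
    e ⬝ᵥ b ≠ 1 → e = 0 ∨ e = g := by
  decide

lemma perp_cases : ∀ a e : Fin 2 → ZMod 2, a ≠ 0 → a ⬝ᵥ e = 0 → e = 0 ∨ e = perp a := by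
  decide

lemma perp_dot_self : ∀ a : Fin 2 → ZMod 2, a ⬝ᵥ perp a = 0 := by decide

lemma perp_ne_zero : ∀ a : Fin 2 → ZMod 2, a ≠ 0 → perp a ≠ 0 := by decide

lemma perp_add (a c : Fin 2 → ZMod 2) : perp (a + c) = perp a + perp c := by
  ext i; fin_cases i <;> simp [perp]

lemma dot_perp : ∀ a c : Fin 2 → ZMod 2, a ≠ 0 → c ≠ 0 → a ≠ c → a ⬝ᵥ perp c = 1 := by
  decide

lemma add_self_vec : ∀ a : Fin 2 → ZMod 2, a + a = 0 := by decide

lemma exists_third : ∀ a : Fin 2 → ZMod 2, ∃ c, c ≠ 0 ∧ c ≠ a := by decide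

/-- The 0/1 lifts of two distinct nonzero vectors form a basis of ℤ², which makes the leading
coefficient of the Jacobian determinant a unit. -/
lemma intLift_det : ∀ a c : Fin 2 → ZMod 2, a ≠ 0 → c ≠ 0 → a ≠ c →
    (intLift a).1 * (intLift c).2 - (intLift a).2 * (intLift c).1 = 1 ∨
    (intLift a).1 * (intLift c).2 - (intLift a).2 * (intLift c).1 = -1 := by
  decide

end Combinatorics

/-! ### Duplication with two surviving terms. -/

lemma sum_eq_two {g β : Fin 2 → ZMod 2} (hg : g ≠ 0) (hβ : β ≠ 0) (hgβ : g ⬝ᵥ β = 0)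
    {f : (Fin 2 → ZMod 2) → ℂ} (hf : ∀ ε, ε ⬝ᵥ β = 1 → f ε = 0) : ∑ ε, f ε = f 0 + f g := by
  rw [← Finset.sum_pair hg.symm]
  symm
  refine Finset.sum_subset (Finset.subset_univ _) fun ε _ hε => hf ε ?_
  by_contra h
  exact hε (by simpa using orthogonal_cases g β ε hg hβ hgβ h)

lemma IsSign.mul {s t : ℂ} (hs : s = 1 ∨ s = -1) (ht : t = 1 ∨ t = -1) :
    s * t = 1 ∨ s * t = -1 := by
  rcases hs with rfl | rfl <;> rcases ht with rfl | rfl <;> simp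

lemma theta_mul_zero {g β : Fin 2 → ZMod 2} (hg : g ≠ 0) (hβ : β ≠ 0) (hgβ : g ⬝ᵥ β = 0)
    (b : Fin 2 → ZMod 2) : ∃ s : ℂ, (s = 1 ∨ s = -1) ∧ ∀ P ∈ siegelCoord,
      theta (0, b) P 0 * theta (0, b + β) P 0 = s * (theta (0, β) ((2 : ℂ) • P) 0 ^ 2 +
        sgn (g ⬝ᵥ b) * theta (g, β) ((2 : ℂ) • P) 0 ^ 2) := by
  obtain ⟨s, hs, h⟩ := theta_mul 0 b β
  refine ⟨s, hs, fun P hP => ?_⟩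
  rw [h P hP 0, sum_eq_two hg hβ hgβ]
  · rw [smul_zero, zero_dotProduct, sgn_zero, dotProduct_add, hgβ, add_zero, add_zero, zero_add]
    ring
  · intro ε hε
    rw [theta_zero_of_odd (m := (ε, β)) hε]
    ring

lemma theta_mul_ne_zero {g β : Fin 2 → ZMod 2} (hg : g ≠ 0) (hβ : β ≠ 0) (hgβ : g ⬝ᵥ β = 0) :
    ∃ s : ℂ, (s = 1 ∨ s = -1) ∧ ∀ P ∈ siegelCoord, theta (g, 0) P 0 * theta (g, β) P 0 =
      s * (2 * (theta (0, β) ((2 : ℂ) • P) 0 * theta (g, β) ((2 : ℂ) • P) 0)) := by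
  obtain ⟨s, hs, h⟩ := theta_mul g 0 β
  refine ⟨s, hs, fun P hP => ?_⟩
  have := h P hP 0
  rw [zero_add] at this
  rw [this, sum_eq_two hg hβ hgβ]
  · rw [smul_zero, zero_dotProduct, sgn_zero, hgβ, sgn_zero, add_zero, add_self_vec]
    ring
  · intro ε hε
    rw [theta_zero_of_odd (m := (ε, β)) hε]
    ring

/-- Only ε = 0 and ε = a + c pair to 0 with β, so the sum involves just the gradients of (a, β) and
(c, β) at 2P. -/
lemma thetaGrad_mul {a c b β : Fin 2 → ZMod 2} (hac : a ≠ c) (hab : a ⬝ᵥ b = 1)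
    (haβ : a ⬝ᵥ β = 1) (hcβ : c ⬝ᵥ β = 1) : ∃ s : ℂ, (s = 1 ∨ s = -1) ∧ ∀ P ∈ siegelCoord, ∀ d,
      thetaGrad (a, b) P d * theta (a, b + β) P 0 =
        s * (2 * (thetaGrad (a, β) ((2 : ℂ) • P) d * theta (0, β) ((2 : ℂ) • P) 0 +
          sgn ((a + c) ⬝ᵥ b) *
            (thetaGrad (c, β) ((2 : ℂ) • P) d * theta (a + c, β) ((2 : ℂ) • P) 0))) := by
  obtain ⟨s, hs, h⟩ := thetaGrad_mul_theta a b β hab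
  refine ⟨s, hs, fun P hP d => ?_⟩
  have hg : a + c ≠ 0 := by
    intro h
    apply hac
    have := congrArg (· + c) h
    simpa [add_assoc, add_self_vec] using this
  have hβ : β ≠ 0 := by rintro rfl; simp at haβ
  have hgβ : (a + c) ⬝ᵥ β = 0 := by rw [add_dotProduct, haβ, hcβ]; decide
  rw [h P hP d, sum_eq_two hg hβ hgβ]
  · rw [zero_dotProduct, sgn_zero, dotProduct_add (a + c), hgβ, add_zero, add_zero, ← add_assoc,
      add_self_vec, zero_add]
    ring
  · intro ε hε
    rw [theta_zero_of_odd (m := (ε, β)) hε]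
    ring

/-! ### Jacobi's derivative formula. -/

/-- The determinant of the gradients of two theta functions. -/
def gradDet (m m' : Characteristic 2) (P : SymCoord) : ℂ :=
  thetaGrad m P (1, 0) * thetaGrad m' P (0, 1) - thetaGrad m P (0, 1) * thetaGrad m' P (1, 0)

lemma lineHolo_gradDet (m m' : Characteristic 2) : LineHolo (gradDet m m') :=
  ((lineHolo_thetaGrad m _).mul (lineHolo_thetaGrad m' _)).sub
    ((lineHolo_thetaGrad m _).mul (lineHolo_thetaGrad m' _))

lemma add_ne_zero_vec {a c : Fin 2 → ZMod 2} (hac : a ≠ c) : a + c ≠ 0 := by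
  intro h
  apply hac
  have := congrArg (· + c) h
  simpa [add_assoc, add_self_vec] using this

lemma ne_zero_of_dot_eq_one {a b : Fin 2 → ZMod 2} (h : a ⬝ᵥ b = 1) : a ≠ 0 := by
  rintro rfl; simp at h

/-- Duplication formula for the Jacobian determinants, distinct first halves. -/
lemma gradDet_duplication {a b c d b₀ β : Fin 2 → ZMod 2} (hac : a ≠ c) (hab : a ⬝ᵥ b = 1)
    (hcd : c ⬝ᵥ d = 1) (haβ : a ⬝ᵥ β = 1) (hcβ : c ⬝ᵥ β = 1)
    (hb₀ : (a + c) ⬝ᵥ b₀ = (a + c) ⬝ᵥ (b + d) + 1) :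
    ∃ s : ℂ, (s = 1 ∨ s = -1) ∧ ∀ P ∈ siegelCoord,
      gradDet (a, b) (c, d) P * (theta (a, b + β) P 0 * theta (c, d + β) P 0) =
        s * (4 * (theta (0, b₀) P 0 * theta (0, b₀ + β) P 0) *
          gradDet (a, β) (c, β) ((2 : ℂ) • P)) := by
  have hgβ : (a + c) ⬝ᵥ β = 0 := by rw [add_dotProduct, haβ, hcβ]; decide
  have hβ : β ≠ 0 := by rintro rfl; simp at haβ
  obtain ⟨s, hs, h1⟩ := thetaGrad_mul hac hab haβ hcβ
  obtain ⟨t, ht, h2⟩ := thetaGrad_mul hac.symm hcd hcβ haβ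
  obtain ⟨r, hr, h3⟩ := theta_mul_zero (add_ne_zero_vec hac) hβ hgβ b₀
  refine ⟨s * t * r, IsSign.mul (IsSign.mul hs ht) hr, fun P hP => ?_⟩
  have hr2 : r * r = 1 := by rcases hr with rfl | rfl <;> simp
  -- With X, Y the theta constants of (0, β), (a + c, β) at 2P and u, v the signs of b, d, the
  -- gradients transform by the matrix (X, uY; vY, X) of determinant X² − uvY². The condition on b₀
  -- makes the product of the two constants θ_(0, b₀), θ_(0, b₀ + β) equal to this determinant up to
  -- sign.
  have hu : sgn ((a + c) ⬝ᵥ b₀) = -(sgn ((a + c) ⬝ᵥ b) * sgn ((a + c) ⬝ᵥ d)) := by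
    rw [hb₀, dotProduct_add, sgn_add, sgn_add, sgn_one]; ring
  rw [h3 P hP, hu]
  simp only [add_comm c a] at h2
  have e1 := h1 P hP (1, 0)
  have e2 := h1 P hP (0, 1)
  have e3 := h2 P hP (1, 0)
  have e4 := h2 P hP (0, 1)
  unfold gradDet
  have e : (thetaGrad (a, b) P (1, 0) * thetaGrad (c, d) P (0, 1) -
      thetaGrad (a, b) P (0, 1) * thetaGrad (c, d) P (1, 0)) *
      (theta (a, b + β) P 0 * theta (c, d + β) P 0) =
      (thetaGrad (a, b) P (1, 0) * theta (a, b + β) P 0) *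
        (thetaGrad (c, d) P (0, 1) * theta (c, d + β) P 0) -
      (thetaGrad (a, b) P (0, 1) * theta (a, b + β) P 0) *
        (thetaGrad (c, d) P (1, 0) * theta (c, d + β) P 0) := by ring
  rw [e, e1, e2, e3, e4]
  set u := sgn ((a + c) ⬝ᵥ b)
  set v := sgn ((a + c) ⬝ᵥ d)
  set g1 := thetaGrad (a, β) ((2 : ℂ) • P) (1, 0)
  set g2 := thetaGrad (a, β) ((2 : ℂ) • P) (0, 1)
  set k1 := thetaGrad (c, β) ((2 : ℂ) • P) (1, 0)
  set k2 := thetaGrad (c, β) ((2 : ℂ) • P) (0, 1)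
  set X := theta (0, β) ((2 : ℂ) • P) 0
  set Y := theta (a + c, β) ((2 : ℂ) • P) 0
  linear_combination (-4 * s * t * (X ^ 2 - u * v * Y ^ 2) * (g1 * k2 - g2 * k1)) * hr2

/-- Duplication formula for the Jacobian determinants, equal first halves. -/
lemma gradDet_duplication_eq {a b c d β : Fin 2 → ZMod 2} (hac : a ≠ c) (hab : a ⬝ᵥ b = 1)
    (had : a ⬝ᵥ d = 1) (hbd : b ≠ d) (haβ : a ⬝ᵥ β = 1) (hcβ : c ⬝ᵥ β = 1) :
    ∃ s : ℂ, (s = 1 ∨ s = -1) ∧ ∀ P ∈ siegelCoord,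
      gradDet (a, b) (a, d) P * (theta (a, b + β) P 0 * theta (a, d + β) P 0) =
        s * (4 * (theta (a + c, 0) P 0 * theta (a + c, β) P 0) *
          gradDet (a, β) (c, β) ((2 : ℂ) • P)) := by
  have hgβ : (a + c) ⬝ᵥ β = 0 := by rw [add_dotProduct, haβ, hcβ]; decide
  have hβ : β ≠ 0 := by rintro rfl; simp at haβ
  have hbd' : b + d = perp a := by
    refine (perp_cases a (b + d) (ne_zero_of_dot_eq_one hab) ?_).resolve_left
      (add_ne_zero_vec hbd)
    rw [dotProduct_add, hab, had]; decide
  have hg : (a + c) ⬝ᵥ perp a = 1 := by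
    rw [add_dotProduct, perp_dot_self, zero_add,
      dot_perp c a (ne_zero_of_dot_eq_one hcβ) (ne_zero_of_dot_eq_one hab) hac.symm]
  obtain ⟨s, hs, h1⟩ := thetaGrad_mul hac hab haβ hcβ
  obtain ⟨t, ht, h2⟩ := thetaGrad_mul hac had haβ hcβ
  obtain ⟨r, hr, h3⟩ := theta_mul_ne_zero (add_ne_zero_vec hac) hβ hgβ
  have hr2 : r * r = 1 := by rcases hr with rfl | rfl <;> simp
  -- The transformation matrix is now (X, uY; X, −uY), with determinant −2uXY, which is the value of
  -- the duplication formula for θ_(a+c, 0) θ_(a+c, β) up to sign.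
  have huv : sgn ((a + c) ⬝ᵥ d) = -sgn ((a + c) ⬝ᵥ b) := by
    have : d = b + perp a := by rw [← hbd', ← add_assoc, add_self_vec, zero_add]
    rw [this, dotProduct_add, sgn_add, hg, sgn_one]; ring
  set u := sgn ((a + c) ⬝ᵥ b)
  have hu : u = 1 ∨ u = -1 := sgn_eq_or _
  refine ⟨s * t * r * (-1 * u), IsSign.mul (IsSign.mul (IsSign.mul hs ht) hr)
    (IsSign.mul (Or.inr rfl) hu), fun P hP => ?_⟩
  rw [h3 P hP]
  rw [huv] at h2
  have e1 := h1 P hP (1, 0)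
  have e2 := h1 P hP (0, 1)
  have e3 := h2 P hP (1, 0)
  have e4 := h2 P hP (0, 1)
  unfold gradDet
  have e : (thetaGrad (a, b) P (1, 0) * thetaGrad (a, d) P (0, 1) -
      thetaGrad (a, b) P (0, 1) * thetaGrad (a, d) P (1, 0)) *
      (theta (a, b + β) P 0 * theta (a, d + β) P 0) =
      (thetaGrad (a, b) P (1, 0) * theta (a, b + β) P 0) *
        (thetaGrad (a, d) P (0, 1) * theta (a, d + β) P 0) -
      (thetaGrad (a, b) P (0, 1) * theta (a, b + β) P 0) *
        (thetaGrad (a, d) P (1, 0) * theta (a, d + β) P 0) := by ring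
  rw [e, e1, e2, e3, e4]
  set g1 := thetaGrad (a, β) ((2 : ℂ) • P) (1, 0)
  set g2 := thetaGrad (a, β) ((2 : ℂ) • P) (0, 1)
  set k1 := thetaGrad (c, β) ((2 : ℂ) • P) (1, 0)
  set k2 := thetaGrad (c, β) ((2 : ℂ) • P) (0, 1)
  set X := theta (0, β) ((2 : ℂ) • P) 0
  set Y := theta (a + c, β) ((2 : ℂ) • P) 0
  linear_combination (8 * s * t * u * X * Y * (g1 * k2 - g2 * k1)) * hr2

/-- The product of theta constants belonging to `D((a, β), (c, β))`, `β = a^⊥ + c^⊥`. -/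
def thetaQuad (a c : Fin 2 → ZMod 2) (P : SymCoord) : ℂ :=
  theta (0, perp a) P 0 * theta (0, perp c) P 0 * (theta (a, perp a) P 0 * theta (c, perp c) P 0)

lemma lineHolo_thetaQuad (a c : Fin 2 → ZMod 2) : LineHolo (thetaQuad a c) :=
  ((lineHolo_theta _).mul (lineHolo_theta _)).mul ((lineHolo_theta _).mul (lineHolo_theta _))

lemma thetaQuad_duplication {a c : Fin 2 → ZMod 2} (ha : a ≠ 0) (hc : c ≠ 0) :
    ∃ s : ℂ, (s = 1 ∨ s = -1) ∧ ∀ P ∈ siegelCoord, 4 * thetaQuad a c ((2 : ℂ) • P) =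
      s * ((theta (a, 0) P 0 * theta (a, perp a) P 0) *
        (theta (c, 0) P 0 * theta (c, perp c) P 0)) := by
  obtain ⟨s, hs, h1⟩ := theta_mul_ne_zero ha (perp_ne_zero a ha) (perp_dot_self a)
  obtain ⟨t, ht, h2⟩ := theta_mul_ne_zero hc (perp_ne_zero c hc) (perp_dot_self c)
  refine ⟨s * t, IsSign.mul hs ht, fun P hP => ?_⟩
  have hs2 : s * s = 1 := by rcases hs with rfl | rfl <;> simp
  have ht2 : t * t = 1 := by rcases ht with rfl | rfl <;> simp
  rw [h1 P hP, h2 P hP, thetaQuad]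
  set x := theta (0, perp a) ((2 : ℂ) • P) 0
  set y := theta (0, perp c) ((2 : ℂ) • P) 0
  set z := theta (a, perp a) ((2 : ℂ) • P) 0
  set w := theta (c, perp c) ((2 : ℂ) • P) 0
  linear_combination (-4 * x * y * z * w * t * t) * hs2 + (-4 * x * y * z * w) * ht2

lemma two_smul_mem {P : SymCoord} (hP : P ∈ siegelCoord) : (2 : ℂ) • P ∈ siegelCoord := by
  simpa using smul_mem_siegelCoord hP (t := 2) two_pos

lemma two_pow_smul_mem {P : SymCoord} (hP : P ∈ siegelCoord) (k : ℕ) :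
    (2 : ℂ) ^ k • P ∈ siegelCoord := by
  simpa using smul_mem_siegelCoord hP (t := 2 ^ k) (by positivity)

lemma dot_perp_add {a c : Fin 2 → ZMod 2} (ha : a ≠ 0) (hc : c ≠ 0) (hac : a ≠ c) :
    a ⬝ᵥ (perp a + perp c) = 1 := by
  rw [dotProduct_add, perp_dot_self, zero_add, dot_perp a c ha hc hac]

lemma dot_perp_add' {a c : Fin 2 → ZMod 2} (ha : a ≠ 0) (hc : c ≠ 0) (hac : a ≠ c) :
    c ⬝ᵥ (perp a + perp c) = 1 := by
  rw [add_comm, dot_perp_add hc ha hac.symm]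

/-- Combining the two duplication formulas and cancelling θ_(a, 0) θ_(c, 0) shows that the quotient
of `gradDet` by `thetaQuad` is invariant up to sign under doubling P. -/
lemma gradDet_mul_thetaQuad {a c : Fin 2 → ZMod 2} (ha : a ≠ 0) (hc : c ≠ 0) (hac : a ≠ c) :
    ∃ s : ℂ, (s = 1 ∨ s = -1) ∧ ∀ P ∈ siegelCoord,
      gradDet (a, perp a + perp c) (c, perp a + perp c) P * thetaQuad a c ((2 : ℂ) • P) =
        s * (thetaQuad a c P *
          gradDet (a, perp a + perp c) (c, perp a + perp c) ((2 : ℂ) • P)) := by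
  set β := perp a + perp c with hβ
  have haβ : a ⬝ᵥ β = 1 := dot_perp_add ha hc hac
  have hcβ : c ⬝ᵥ β = 1 := dot_perp_add' ha hc hac
  have hb₀ : (a + c) ⬝ᵥ perp a = (a + c) ⬝ᵥ (β + β) + 1 := by
    rw [add_self_vec, dotProduct_zero, zero_add, add_dotProduct, perp_dot_self, zero_add,
      dot_perp c a hc ha hac.symm]
  obtain ⟨s, hs, h1⟩ := gradDet_duplication hac haβ hcβ haβ hcβ hb₀
  obtain ⟨t, ht, h2⟩ := thetaQuad_duplication ha hc
  refine ⟨s * t, IsSign.mul hs ht, fun P hP => ?_⟩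
  have hG : LineHolo fun P => theta (a, 0) P 0 * theta (c, 0) P 0 :=
    (lineHolo_theta _).mul (lineHolo_theta _)
  refine LineHolo.eq_of_mul_eq (F := fun P => gradDet (a, β) (c, β) P *
    thetaQuad a c ((2 : ℂ) • P)) (F' := fun P => s * t * (thetaQuad a c P *
    gradDet (a, β) (c, β) ((2 : ℂ) • P))) ?_ ?_ hG (fun P hP => ?_) ?_ hP
  · have := (lineHolo_thetaQuad a c).comp_smul (t := 2) two_pos
    exact (lineHolo_gradDet _ _).mul (by simpa using this)
  · have := (lineHolo_gradDet (a, β) (c, β)).comp_smul (t := 2) two_pos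
    exact (LineHolo.const _).mul ((lineHolo_thetaQuad a c).mul (by simpa using this))
  · have e1 := h1 P hP
    have e2 := h2 P hP
    have h0 : perp a + β = perp c := by rw [hβ, ← add_assoc, add_self_vec, zero_add]
    rw [add_self_vec, h0] at e1
    have e3 : thetaQuad a c P = theta (0, perp a) P 0 * theta (0, perp c) P 0 *
      (theta (a, perp a) P 0 * theta (c, perp c) P 0) := rfl
    rw [e3]
    have e2' : thetaQuad a c ((2 : ℂ) • P) = t / 4 * ((theta (a, 0) P 0 * theta (a, perp a) P 0) *
        (theta (c, 0) P 0 * theta (c, perp c) P 0)) := by linear_combination e2 / 4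
    simp only [e2']
    linear_combination (t / 4 * ((theta (a, 0) P 0 * theta (a, perp a) P 0) *
        (theta (c, 0) P 0 * theta (c, perp c) P 0))) * e1
  · exact (lineHolo_theta _).exists_mul_ne_zero (lineHolo_theta _)
      (exists_theta_ne_zero (m := (a, 0)) (dotProduct_zero _))
      (exists_theta_ne_zero (m := (c, 0)) (dotProduct_zero _))

lemma exists_thetaQuad_ne_zero (a c : Fin 2 → ZMod 2) :
    ∃ P ∈ siegelCoord, thetaQuad a c P ≠ 0 :=
  LineHolo.exists_mul_ne_zero ((lineHolo_theta _).mul (lineHolo_theta _))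
    ((lineHolo_theta _).mul (lineHolo_theta _))
    ((lineHolo_theta _).exists_mul_ne_zero (lineHolo_theta _)
      (exists_theta_ne_zero (m := (0, perp a)) (zero_dotProduct _))
      (exists_theta_ne_zero (m := (0, perp c)) (zero_dotProduct _)))
    ((lineHolo_theta _).exists_mul_ne_zero (lineHolo_theta _)
      (exists_theta_ne_zero (m := (a, perp a)) (perp_dot_self a))
      (exists_theta_ne_zero (m := (c, perp c)) (perp_dot_self c)))

lemma gradDet_mul_thetaQuad_pow {a c : Fin 2 → ZMod 2} (ha : a ≠ 0) (hc : c ≠ 0) (hac : a ≠ c) :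
    ∃ s : ℂ, (s = 1 ∨ s = -1) ∧ ∀ k : ℕ, ∀ P ∈ siegelCoord,
      gradDet (a, perp a + perp c) (c, perp a + perp c) P * thetaQuad a c ((2 : ℂ) ^ k • P) =
        s ^ k * (thetaQuad a c P *
          gradDet (a, perp a + perp c) (c, perp a + perp c) ((2 : ℂ) ^ k • P)) := by
  obtain ⟨s, hs, h⟩ := gradDet_mul_thetaQuad ha hc hac
  set β := perp a + perp c
  refine ⟨s, hs, fun k => ?_⟩
  induction k with
  | zero => intro P hP; simp; ring
  | succ k ih =>
    intro P hP
    have hs2 (j : ℕ) {F : SymCoord → ℂ} (hF : LineHolo F) :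
        LineHolo fun P => F ((2 : ℂ) ^ j • P) := by
      have := hF.comp_smul (t := 2 ^ j) (by positivity)
      simpa using this
    -- Rescaling a point where `thetaQuad` is nonzero justifies cancelling its value at 2^k P in the
    -- induction.
    have hne : ∃ P ∈ siegelCoord, thetaQuad a c ((2 : ℂ) ^ k • P) ≠ 0 := by
      obtain ⟨P, hP, h⟩ := exists_thetaQuad_ne_zero a c
      refine ⟨((2 : ℂ) ^ k)⁻¹ • P, ?_, ?_⟩
      · simpa using smul_mem_siegelCoord hP (t := ((2 : ℝ) ^ k)⁻¹) (by positivity)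
      · have : (2 : ℂ) ^ k • ((2 : ℂ) ^ k)⁻¹ • P = P := by
          rw [smul_smul, mul_inv_cancel₀ (pow_ne_zero k two_ne_zero), one_smul]
        rwa [this]
    refine LineHolo.eq_of_mul_eq
      ((lineHolo_gradDet (a, β) (c, β)).mul (hs2 (k + 1) (lineHolo_thetaQuad a c)))
      ((LineHolo.const _).mul ((lineHolo_thetaQuad a c).mul
        (hs2 (k + 1) (lineHolo_gradDet (a, β) (c, β)))))
      (hs2 k (lineHolo_thetaQuad a c)) (fun P hP => ?_) hne hP
    have e1 := ih P hP
    have e2 := h _ (two_pow_smul_mem hP k)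
    rw [smul_smul, ← pow_succ'] at e2
    set x := thetaQuad a c ((2 : ℂ) ^ (k + 1) • P)
    set y := thetaQuad a c ((2 : ℂ) ^ k • P)
    linear_combination x * e1 + (s ^ k * thetaQuad a c P) * e2

lemma leadFactor_zero (P : SymCoord) : leadFactor 0 P = 1 := by
  simp [leadFactor, intLift, shiftPt, quadForm, cpt]

lemma tendsto_thetaQuad {a c : Fin 2 → ZMod 2} (ha : a ≠ 0) (hc : c ≠ 0) :
    ∃ l : ℂ, (l = 1 ∨ l = -1) ∧ ∀ P ∈ obtuseCoord,
      Tendsto (fun k : ℕ => leadFactor a P ^ (2 ^ k) * leadFactor c P ^ (2 ^ k) *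
        thetaQuad a c ((2 : ℂ) ^ k • P)) atTop (𝓝 (4 * l)) := by
  obtain ⟨l1, hl1, h1⟩ := tendsto_theta (m := (0, perp a)) (zero_dotProduct _)
  obtain ⟨l2, hl2, h2⟩ := tendsto_theta (m := (0, perp c)) (zero_dotProduct _)
  obtain ⟨l3, hl3, h3⟩ := tendsto_theta (m := (a, perp a)) (perp_dot_self a)
  obtain ⟨l4, hl4, h4⟩ := tendsto_theta (m := (c, perp c)) (perp_dot_self c)
  refine ⟨l1 * l2 * (l3 * l4), IsSign.mul (IsSign.mul hl1 hl2) (IsSign.mul hl3 hl4),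
    fun P hP => ?_⟩
  have := ((h1 P hP).mul (h2 P hP)).mul ((h3 P hP).mul (h4 P hP))
  simp only [if_neg ha, if_neg hc, if_true, leadFactor_zero, one_pow, one_mul] at this
  convert this using 2
  · unfold thetaQuad; ring
  · ring

lemma tendsto_gradDet {a c β : Fin 2 → ZMod 2} (ha : a ⬝ᵥ β = 1) (hc : c ⬝ᵥ β = 1)
    (hac : a ≠ c) : ∃ l : ℂ, (l = 1 ∨ l = -1) ∧ ∀ P ∈ obtuseCoord,
      Tendsto (fun k : ℕ => leadFactor a P ^ (2 ^ k) * leadFactor c P ^ (2 ^ k) *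
        gradDet (a, β) (c, β) ((2 : ℂ) ^ k • P)) atTop (𝓝 (4 * Real.pi ^ 2 * l)) := by
  obtain hdet := intLift_det a c (ne_zero_of_dot_eq_one ha) (ne_zero_of_dot_eq_one hc) hac
  set D : ℂ := (intLift a).1 * (intLift c).2 - (intLift a).2 * (intLift c).1 with hD
  have hD1 : D = 1 ∨ D = -1 := by
    rcases hdet with h | h
    · left; rw [hD]; exact_mod_cast h
    · right; rw [hD]; exact_mod_cast h
  set s1 := sgn ((((intLift a).1 * (intLift β).1 + (intLift a).2 * (intLift β).2) / 2 : ℤ) :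
          ZMod 2)
  set s2 := sgn ((((intLift c).1 * (intLift β).1 + (intLift c).2 * (intLift β).2) / 2 : ℤ) :
          ZMod 2)
  refine ⟨D * (s1 * s2), IsSign.mul hD1 (IsSign.mul (sgn_eq_or _) (sgn_eq_or _)), fun P hP => ?_⟩
  have h1 := tendsto_thetaGrad (m := (a, β)) ha hP
  have h2 := tendsto_thetaGrad (m := (c, β)) hc hP
  have := ((h1 (1, 0)).mul (h2 (0, 1))).sub ((h1 (0, 1)).mul (h2 (1, 0)))
  convert this using 2
  · unfold gradDet; ring
  · rw [hD]; ring

/-- Numerator and denominator have the same normalising factor along 2^k P and the limits 4π²·(±1)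
and 4·(±1), so their doubling-invariant quotient is ±π² on `obtuseCoord`; the identity theorem
extends this. -/
lemma gradDet_eq_thetaQuad {a c : Fin 2 → ZMod 2} (ha : a ≠ 0) (hc : c ≠ 0) (hac : a ≠ c) :
    ∃ s : ℂ, (s = 1 ∨ s = -1) ∧ ∀ P ∈ siegelCoord,
      gradDet (a, perp a + perp c) (c, perp a + perp c) P =
        s * (Real.pi ^ 2 * thetaQuad a c P) := by
  set β := perp a + perp c with hβ
  obtain ⟨s, hs, h⟩ := gradDet_mul_thetaQuad_pow ha hc hac
  obtain ⟨l, hl, h1⟩ := tendsto_thetaQuad ha hc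
  obtain ⟨r, hr, h2⟩ := tendsto_gradDet (dot_perp_add ha hc hac) (dot_perp_add' ha hc hac) hac
  have hs2 : s ^ 2 = 1 := by rcases hs with rfl | rfl <;> simp
  have hl2 : l * l = 1 := by rcases hl with rfl | rfl <;> simp
  have key (P : SymCoord) (hP : P ∈ obtuseCoord) :
      gradDet (a, β) (c, β) P = r * l * (Real.pi ^ 2 * thetaQuad a c P) := by
    -- Only even exponents are used, so that the unknown sign s ^ k becomes 1.
    have ht : Tendsto (fun k : ℕ => 2 * k) atTop atTop :=
      tendsto_id.const_mul_atTop' two_pos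
    have t1 := ((h1 P hP).comp ht).const_mul (gradDet (a, β) (c, β) P)
    have t2 := ((h2 P hP).comp ht).const_mul (thetaQuad a c P)
    have heq := tendsto_nhds_unique (t1.congr fun k => ?_) t2
    · have : gradDet (a, β) (c, β) P * (4 * l) * l = thetaQuad a c P * (4 * Real.pi ^ 2 * r) * l :=
        by rw [heq]
      linear_combination this / 4 - gradDet (a, β) (c, β) P * hl2
    · simp only [Function.comp_apply]
      have := h (2 * k) P (obtuseCoord_subset hP)
      rw [pow_mul s, hs2, one_pow, one_mul] at this
      linear_combination (leadFactor a P ^ 2 ^ (2 * k) * leadFactor c P ^ 2 ^ (2 * k)) * this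
  refine ⟨r * l, IsSign.mul hr hl, fun P hP => ?_⟩
  obtain ⟨P₀, hP₀⟩ := exists_mem_obtuseCoord
  refine sub_eq_zero.mp (LineHolo.eq_zero (F := fun P => gradDet (a, β) (c, β) P -
    r * l * (Real.pi ^ 2 * thetaQuad a c P)) ((lineHolo_gradDet _ _).sub ((LineHolo.const _).mul
      ((LineHolo.const _).mul (lineHolo_thetaQuad a c)))) (obtuseCoord_subset hP₀)
      (fun V => ?_) hP)
  have hc : Continuous fun w : ℂ => P₀ + w • V := by fun_prop
  have : ∀ᶠ w in 𝓝 (0 : ℂ), P₀ + w • V ∈ obtuseCoord :=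
    hc.continuousAt.eventually_mem (isOpen_obtuseCoord.mem_nhds (by simpa using hP₀))
  filter_upwards [this] with w hw
  rw [key _ hw, sub_self]

/-- The even characteristics with first half a ≠ 0 are (a, 0) and (a, a^⊥), and adding a^⊥
interchanges them. -/
lemma theta_pair {a e : Fin 2 → ZMod 2} (ha : a ≠ 0) (he : a ⬝ᵥ e = 0) (P : SymCoord) :
    theta (a, 0) P 0 * theta (a, perp a) P 0 = theta (a, e) P 0 * theta (a, e + perp a) P 0 := by
  rcases perp_cases a e ha he with rfl | rfl
  · rw [zero_add]
  · rw [add_self_vec, mul_comm]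

/-- Duplication leads from D at P to the base determinant at 2P, which is known;
`thetaQuad_duplication` returns to P, and the auxiliary constants cancel. -/
lemma gradDet_of_ne {a b c d : Fin 2 → ZMod 2} (hab : a ⬝ᵥ b = 1) (hcd : c ⬝ᵥ d = 1)
    (hac : a ≠ c) : ∃ s : ℂ, (s = 1 ∨ s = -1) ∧ ∀ P ∈ siegelCoord,
      gradDet (a, b) (c, d) P = s * (Real.pi ^ 2 * (theta (0, b + d + perp a) P 0 *
        (theta (0, b + d + perp c) P 0 * (theta (a, b + perp c) P 0 *
          theta (c, d + perp a) P 0)))) := by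
  have ha := ne_zero_of_dot_eq_one hab
  have hc := ne_zero_of_dot_eq_one hcd
  set β := perp a + perp c with hβ
  have haβ : a ⬝ᵥ β = 1 := dot_perp_add ha hc hac
  have hcβ : c ⬝ᵥ β = 1 := dot_perp_add' ha hc hac
  have hb₀ : (a + c) ⬝ᵥ (b + d + perp a) = (a + c) ⬝ᵥ (b + d) + 1 := by
    rw [dotProduct_add, add_dotProduct a c (perp a), perp_dot_self, zero_add,
      dot_perp c a hc ha hac.symm]
  obtain ⟨s, hs, h1⟩ := gradDet_duplication hac hab hcd haβ hcβ hb₀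
  obtain ⟨t, ht, h2⟩ := thetaQuad_duplication ha hc
  obtain ⟨r, hr, h3⟩ := gradDet_eq_thetaQuad ha hc hac
  refine ⟨s * t * r, IsSign.mul (IsSign.mul hs ht) hr, fun P hP => ?_⟩
  have hae : a ⬝ᵥ (b + β) = 0 := by rw [dotProduct_add, hab, haβ]; decide
  have hce : c ⬝ᵥ (d + β) = 0 := by rw [dotProduct_add, hcd, hcβ]; decide
  have h4 : b + d + perp a + β = b + d + perp c := by
    rw [hβ, add_assoc (b + d), ← add_assoc (perp a), add_self_vec, zero_add]
  have h5 : b + β + perp a = b + perp c := by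
    rw [hβ, add_assoc b, add_right_comm (perp a), add_self_vec, zero_add]
  have h6 : d + β + perp c = d + perp a := by
    rw [hβ, add_assoc d, add_assoc (perp a), add_self_vec, add_zero]
  have hG : LineHolo fun P => theta (a, b + β) P 0 * theta (c, d + β) P 0 :=
    (lineHolo_theta _).mul (lineHolo_theta _)
  refine LineHolo.eq_of_mul_eq (F' := fun P => s * t * r * (Real.pi ^ 2 *
    (theta (0, b + d + perp a) P 0 * (theta (0, b + d + perp c) P 0 *
      (theta (a, b + perp c) P 0 * theta (c, d + perp a) P 0))))) (lineHolo_gradDet _ _)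
    ((LineHolo.const _).mul ((LineHolo.const _).mul ((lineHolo_theta _).mul
      ((lineHolo_theta _).mul ((lineHolo_theta _).mul (lineHolo_theta _))))))
    hG (fun P hP => ?_) ?_ hP
  · have e1 := h1 P hP
    have e2 := h2 P hP
    rw [theta_pair ha hae, theta_pair hc hce, h5, h6] at e2
    rw [h3 _ (two_smul_mem hP), h4] at e1
    rw [e1]
    linear_combination (s * r * Real.pi ^ 2 * (theta (0, b + d + perp a) P 0 *
      theta (0, b + d + perp c) P 0)) * e2
  · exact (lineHolo_theta _).exists_mul_ne_zero (lineHolo_theta _)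
      (exists_theta_ne_zero (m := (a, b + β)) hae) (exists_theta_ne_zero (m := (c, d + β)) hce)

lemma gradDet_of_eq {a b c d : Fin 2 → ZMod 2} (hab : a ⬝ᵥ b = 1) (had : a ⬝ᵥ d = 1)
    (hbd : b ≠ d) (hc : c ≠ 0) (hca : c ≠ a) : ∃ s : ℂ, (s = 1 ∨ s = -1) ∧ ∀ P ∈ siegelCoord,
      gradDet (a, b) (a, d) P = s * (Real.pi ^ 2 * (theta (a + c, 0) P 0 *
        (theta (a + c, perp (a + c)) P 0 * (theta (c, 0) P 0 * theta (c, perp c) P 0)))) := by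
  have ha := ne_zero_of_dot_eq_one hab
  set β := perp a + perp c with hβ
  have haβ : a ⬝ᵥ β = 1 := dot_perp_add ha hc hca.symm
  have hcβ : c ⬝ᵥ β = 1 := dot_perp_add' ha hc hca.symm
  obtain ⟨s, hs, h1⟩ := gradDet_duplication_eq hca.symm hab had hbd haβ hcβ
  obtain ⟨t, ht, h2⟩ := thetaQuad_duplication ha hc
  obtain ⟨r, hr, h3⟩ := gradDet_eq_thetaQuad ha hc hca.symm
  refine ⟨s * t * r, IsSign.mul (IsSign.mul hs ht) hr, fun P hP => ?_⟩
  have hab' : a ⬝ᵥ (b + β) = 0 := by rw [dotProduct_add, hab, haβ]; decide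
  have had' : a ⬝ᵥ (d + β) = 0 := by rw [dotProduct_add, had, haβ]; decide
  have hbd' : b + d = perp a := by
    refine (perp_cases a (b + d) ha ?_).resolve_left (add_ne_zero_vec hbd)
    rw [dotProduct_add, hab, had]; decide
  have h5 : b + β + perp a = d + β := by
    have : b + β + (b + d) = (b + b) + (d + β) := by abel
    rw [← hbd', this, add_self_vec, zero_add]
  have hG : LineHolo fun P => theta (a, b + β) P 0 * theta (a, d + β) P 0 :=
    (lineHolo_theta _).mul (lineHolo_theta _)
  refine LineHolo.eq_of_mul_eq (F' := fun P => s * t * r * (Real.pi ^ 2 *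
    (theta (a + c, 0) P 0 * (theta (a + c, perp (a + c)) P 0 *
      (theta (c, 0) P 0 * theta (c, perp c) P 0))))) (lineHolo_gradDet _ _)
    ((LineHolo.const _).mul ((LineHolo.const _).mul ((lineHolo_theta _).mul
      ((lineHolo_theta _).mul ((lineHolo_theta _).mul (lineHolo_theta _))))))
    hG (fun P hP => ?_) ?_ hP
  · have e1 := h1 P hP
    have e2 := h2 P hP
    rw [theta_pair ha hab', h5] at e2
    rw [h3 _ (two_smul_mem hP), hβ, ← perp_add, perp_add, ← hβ] at e1
    rw [e1, perp_add, ← hβ]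
    linear_combination (s * r * Real.pi ^ 2 * (theta (a + c, 0) P 0 *
      theta (a + c, β) P 0)) * e2
  · exact (lineHolo_theta _).exists_mul_ne_zero (lineHolo_theta _)
      (exists_theta_ne_zero (m := (a, b + β)) hab') (exists_theta_ne_zero (m := (a, d + β)) had')

/-! ### Genus-one theta constants on the imaginary axis. -/

/-- The theta constant of genus one on the imaginary axis. -/
def thetaAxis (c e : ZMod 2) (t : ℝ) : ℂ :=
  ∑' n : ℤ, Complex.exp (Real.pi * Complex.I *
    (Complex.I * t * (n + (c.val : ℂ) / 2) ^ 2 + (n + (c.val : ℂ) / 2) * e.val))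

lemma summable_norm_thetaAxis (c e : ZMod 2) {t : ℝ} (ht : 0 < t) :
    Summable fun n : ℤ => ‖Complex.exp (Real.pi * Complex.I *
      (Complex.I * t * (n + (c.val : ℂ) / 2) ^ 2 + (n + (c.val : ℂ) / 2) * e.val))‖ := by
  refine (HurwitzZeta.hasSum_int_evenKernel ((c.val : ℝ) / 2) ht).summable.congr fun n => ?_
  rw [Complex.norm_exp]
  congr 1
  have e1 : (n + (c.val : ℂ) / 2) = ((n + (c.val : ℝ) / 2 : ℝ) : ℂ) := by push_cast; rfl
  have e2 : (e.val : ℂ) = ((e.val : ℝ) : ℂ) := by push_cast; rfl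
  have e3 : Real.pi * Complex.I *
      (Complex.I * t * ((n + (c.val : ℝ) / 2 : ℝ) : ℂ) ^ 2 +
        ((n + (c.val : ℝ) / 2 : ℝ) : ℂ) * ((e.val : ℝ) : ℂ)) =
      ((-Real.pi * (n + (c.val : ℝ) / 2) ^ 2 * t : ℝ) : ℂ) +
        ((Real.pi * (n + (c.val : ℝ) / 2) * e.val : ℝ) : ℂ) * Complex.I := by
    push_cast
    linear_combination (Real.pi * t * (n + (c.val : ℂ) / 2) ^ 2) * Complex.I_sq
  rw [e1, e2, e3, Complex.add_re, Complex.ofReal_re, Complex.re_ofReal_mul, Complex.I_re, mul_zero,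
    add_zero]

lemma theta_diag (m : Characteristic 2) {t u : ℝ} (ht : 0 < t) (hu : 0 < u) :
    theta m (Complex.I * t, 0, Complex.I * u) 0 =
      thetaAxis (m.1 0) (m.2 0) t * thetaAxis (m.1 1) (m.2 1) u := by
  unfold thetaAxis
  rw [tsum_mul_tsum_of_summable_norm (summable_norm_thetaAxis _ _ ht)
    (summable_norm_thetaAxis _ _ hu), theta, thetaInt]
  refine tsum_congr fun n => ?_
  rw [wterm_thetaWeight, ← Complex.exp_add]
  congr 1
  simp only [quadForm, cpt, shiftPt, thetaLin, intLift, Prod.fst_zero, Prod.snd_zero]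
  push_cast
  ring

/-- The genus-one even theta constants on the imaginary axis as real kernels. -/
def axisKernel (c e : ZMod 2) (t : ℝ) : ℝ :=
  if c = 1 then HurwitzZeta.evenKernel ((1 / 2 : ℝ) : UnitAddCircle) t
  else if e = 1 then HurwitzZeta.cosKernel ((1 / 2 : ℝ) : UnitAddCircle) t
  else HurwitzZeta.cosKernel ((0 : ℝ) : UnitAddCircle) t

lemma thetaAxis_eq {c e : ZMod 2} (h : ¬(c = 1 ∧ e = 1)) {t : ℝ} (ht : 0 < t) :
    thetaAxis c e t = axisKernel c e t := by
  have hz : ∀ x : ZMod 2, x = 0 ∨ x = 1 := by decide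
  have v1 : (1 : ZMod 2).val = 1 := rfl
  have v0 : (0 : ZMod 2).val = 0 := rfl
  have e01 : (0 : ZMod 2) ≠ 1 := by decide
  unfold thetaAxis axisKernel
  rcases hz c with rfl | rfl <;> rcases hz e with rfl | rfl
  · rw [if_neg e01, if_neg e01, ← (HurwitzZeta.hasSum_int_cosKernel 0 ht).tsum_eq]
    refine tsum_congr fun n => ?_
    rw [Complex.ofReal_exp, ← Complex.exp_add, v0]
    congr 1
    push_cast
    linear_combination (Real.pi * t * n ^ 2 : ℂ) * Complex.I_sq
  · rw [if_neg e01, if_pos rfl, ← (HurwitzZeta.hasSum_int_cosKernel (1 / 2) ht).tsum_eq]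
    refine tsum_congr fun n => ?_
    rw [Complex.ofReal_exp, ← Complex.exp_add, v0, v1]
    congr 1
    push_cast
    linear_combination (Real.pi * t * n ^ 2 : ℂ) * Complex.I_sq
  · rw [if_pos rfl, ← (HurwitzZeta.hasSum_int_evenKernel (1 / 2) ht).tsum_eq, Complex.ofReal_tsum]
    refine tsum_congr fun n => ?_
    rw [Complex.ofReal_exp, v0, v1]
    congr 1
    push_cast
    linear_combination (Real.pi * t * (n + 1 / 2) ^ 2 : ℂ) * Complex.I_sq
  · exact absurd ⟨rfl, rfl⟩ h

/-- The substitution n ↦ −1 − n changes the sign of every term. -/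
lemma thetaAxis_one_one (t : ℝ) : thetaAxis 1 1 t = 0 := by
  have v1 : (1 : ZMod 2).val = 1 := rfl
  have h : thetaAxis 1 1 t = -thetaAxis 1 1 t := by
    unfold thetaAxis
    rw [← tsum_neg]
    conv_lhs => rw [← (Equiv.subLeft (-1 : ℤ)).tsum_eq]
    refine tsum_congr fun n => ?_
    have e1 : Complex.exp (Real.pi * Complex.I * ((-2 * n - 1 : ℤ) : ℂ)) = -1 := by
      rw [exp_pi_mul_I_int]
      push_cast
      rw [show (2 : ZMod 2) = 0 from rfl, neg_zero, zero_mul, zero_sub,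
        show (-1 : ZMod 2) = 1 from rfl, sgn_one]
    rw [← mul_neg_one (Complex.exp _), ← e1, ← Complex.exp_add, v1]
    congr 1
    simp only [Equiv.subLeft_apply]
    push_cast
    ring
  exact self_eq_neg.mp h

lemma evenKernel_half_pos {t : ℝ} (ht : 0 < t) :
    0 < HurwitzZeta.evenKernel ((1 / 2 : ℝ) : UnitAddCircle) t := by
  have h := HurwitzZeta.hasSum_int_evenKernel (1 / 2) ht
  rw [← h.tsum_eq]
  exact h.summable.tsum_pos (fun n => (Real.exp_pos _).le) 0 (Real.exp_pos _)

lemma cosKernel_zero_pos {t : ℝ} (ht : 0 < t) :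
    0 < HurwitzZeta.cosKernel ((0 : ℝ) : UnitAddCircle) t := by
  have h := HurwitzZeta.hasSum_int_evenKernel 0 ht
  have e : HurwitzZeta.cosKernel ((0 : ℝ) : UnitAddCircle) =
      HurwitzZeta.evenKernel ((0 : ℝ) : UnitAddCircle) := by
    rw [AddCircle.coe_zero, HurwitzZeta.evenKernel_eq_cosKernel_of_zero]
  rw [e, ← h.tsum_eq]
  exact h.summable.tsum_pos (fun n => (Real.exp_pos _).le) 0 (Real.exp_pos _)

lemma evenKernel_inv {a : UnitAddCircle} {t : ℝ} (ht : 0 < t) :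
    HurwitzZeta.evenKernel a t⁻¹ = t ^ (1 / 2 : ℝ) * HurwitzZeta.cosKernel a t := by
  rw [HurwitzZeta.evenKernel_functional_equation, one_div t⁻¹, inv_inv, Real.inv_rpow ht.le,
    one_div, inv_inv]

lemma cosKernel_inv {a : UnitAddCircle} {t : ℝ} (ht : 0 < t) :
    HurwitzZeta.cosKernel a t⁻¹ = t ^ (1 / 2 : ℝ) * HurwitzZeta.evenKernel a t := by
  have := HurwitzZeta.evenKernel_functional_equation a t
  rw [this, one_div t, ← mul_assoc, mul_one_div_cancel (Real.rpow_pos_of_pos ht _).ne', one_mul]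

/-- The defining series alternates in sign; positivity is read off from the functional equation,
which turns it into a series of positive terms. -/
lemma cosKernel_half_pos {t : ℝ} (ht : 0 < t) :
    0 < HurwitzZeta.cosKernel ((1 / 2 : ℝ) : UnitAddCircle) t := by
  have := cosKernel_inv (a := ((1 / 2 : ℝ) : UnitAddCircle)) (inv_pos.mpr ht)
  rw [inv_inv] at this
  rw [this]
  exact mul_pos (Real.rpow_pos_of_pos (inv_pos.mpr ht) _) (evenKernel_half_pos (inv_pos.mpr ht))

lemma axisKernel_pos (c e : ZMod 2) {t : ℝ} (ht : 0 < t) : 0 < axisKernel c e t := by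
  unfold axisKernel
  split_ifs
  · exact evenKernel_half_pos ht
  · exact cosKernel_half_pos ht
  · exact cosKernel_zero_pos ht

lemma tendsto_exp_neg_mul {p : ℝ} (hp : 0 < p) :
    Tendsto (fun t : ℝ => Real.exp (-p * t)) atTop (𝓝 0) := by
  have := tendsto_rpow_mul_exp_neg_mul_atTop_nhds_zero 0 p hp
  simpa using this

lemma tendsto_cosKernel (a : UnitAddCircle) :
    Tendsto (HurwitzZeta.cosKernel a) atTop (𝓝 1) := by
  obtain ⟨p, hp, h⟩ := HurwitzZeta.isBigO_atTop_cosKernel_sub a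
  have := (h.trans_tendsto (tendsto_exp_neg_mul hp)).add_const 1
  simpa using this

lemma half_ne_zero_circle : ((1 / 2 : ℝ) : UnitAddCircle) ≠ 0 := by
  intro h
  rw [AddCircle.coe_eq_zero_iff] at h
  obtain ⟨n, hn⟩ := h
  rw [zsmul_one] at hn
  have : (2 * n : ℝ) = 1 := by rw [hn]; norm_num
  have : 2 * n = 1 := by exact_mod_cast this
  omega

lemma tendsto_rpow_mul_evenKernel (s : ℝ) :
    Tendsto (fun t : ℝ => t ^ s * HurwitzZeta.evenKernel ((1 / 2 : ℝ) : UnitAddCircle) t) atTop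
      (𝓝 0) := by
  obtain ⟨p, hp, h⟩ := HurwitzZeta.isBigO_atTop_evenKernel_sub ((1 / 2 : ℝ) : UnitAddCircle)
  simp only [half_ne_zero_circle, if_false, sub_zero] at h
  exact ((Asymptotics.isBigO_refl (fun t : ℝ => t ^ s) atTop).mul h).trans_tendsto
    (tendsto_rpow_mul_exp_neg_mul_atTop_nhds_zero s p hp)

lemma tendsto_evenKernel_half :
    Tendsto (HurwitzZeta.evenKernel ((1 / 2 : ℝ) : UnitAddCircle)) atTop (𝓝 0) := by
  simpa using tendsto_rpow_mul_evenKernel 0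

section Axis

local notation "f₀" => HurwitzZeta.cosKernel (((0 : ℝ)) : UnitAddCircle)
local notation "f₁" => HurwitzZeta.cosKernel (((1 / 2 : ℝ)) : UnitAddCircle)
local notation "f₂" => HurwitzZeta.evenKernel (((1 / 2 : ℝ)) : UnitAddCircle)

/-- As t → ∞, f₂ tends to 0 while f₀ and f₁ tend to 1; a surplus power of f₂ on the left would force
K = 0. -/
lemma axis_exponent_two_le {x y z x' y' z' : ℕ} {K : ℝ} (hK : 0 < K)
    (h : ∀ t : ℝ, 0 < t → f₀ t ^ x * f₁ t ^ y * f₂ t ^ z = K * (f₀ t ^ x' * f₁ t ^ y' * f₂ t ^ z')) :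
    z ≤ z' := by
  by_contra! hz
  obtain ⟨j, rfl⟩ := Nat.exists_eq_add_of_lt hz
  have e : ∀ᶠ t : ℝ in atTop,
      f₀ t ^ x * f₁ t ^ y * f₂ t ^ (j + 1) = K * (f₀ t ^ x' * f₁ t ^ y') := by
    filter_upwards [eventually_gt_atTop 0] with t ht
    have hne := (pow_pos (evenKernel_half_pos ht) z').ne'
    apply mul_right_cancel₀ hne
    have := h t ht
    rw [add_assoc, pow_add] at this
    linear_combination this
  have l1 := (((tendsto_cosKernel ((0 : ℝ) : UnitAddCircle)).pow x).mul
    ((tendsto_cosKernel ((1 / 2 : ℝ) : UnitAddCircle)).pow y)).mul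
    (tendsto_evenKernel_half.pow (j + 1))
  have l2 := (((tendsto_cosKernel ((0 : ℝ) : UnitAddCircle)).pow x').mul
    ((tendsto_cosKernel ((1 / 2 : ℝ) : UnitAddCircle)).pow y')).const_mul K
  have := tendsto_nhds_unique (l1.congr' e) l2
  simp at this
  exact hK.ne this

/-- The inversion t ↦ 1/t exchanges f₁ and f₂ up to powers of √t, so the previous argument applies
at t → 0; exponential decay of f₂ absorbs those powers. -/
lemma axis_exponent_one_le {x y z x' y' z' : ℕ} {K : ℝ} (hK : 0 < K)
    (h : ∀ t : ℝ, 0 < t → f₀ t ^ x * f₁ t ^ y * f₂ t ^ z = K * (f₀ t ^ x' * f₁ t ^ y' * f₂ t ^ z')) :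
    y ≤ y' := by
  by_contra! hz
  obtain ⟨j, rfl⟩ := Nat.exists_eq_add_of_lt hz
  have h0 : f₀ = HurwitzZeta.evenKernel ((0 : ℝ) : UnitAddCircle) := by
    rw [AddCircle.coe_zero, HurwitzZeta.evenKernel_eq_cosKernel_of_zero]
  set N := x + (y' + j + 1) + z with hN
  -- An inequality suffices: for t ≥ 1 the power of √t on the side of K is at least 1 and is
  -- dropped.
  have e : ∀ᶠ t : ℝ in atTop, K * (f₀ t ^ x' * f₁ t ^ z') ≤
      f₀ t ^ x * f₁ t ^ z * f₂ t ^ j * (t ^ ((1 / 2 : ℝ) * N) * f₂ t) := by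
    filter_upwards [eventually_ge_atTop 1] with t ht1
    have ht : 0 < t := by linarith
    have hne := pow_pos (evenKernel_half_pos ht) y'
    have h1 := h t⁻¹ (inv_pos.mpr ht)
    have h00 : f₀ t⁻¹ = t ^ (1 / 2 : ℝ) * f₀ t := by
      rw [cosKernel_inv ht, ← h0]
    rw [h00, cosKernel_inv ht, evenKernel_inv ht] at h1
    rw [Real.rpow_mul ht.le, Real.rpow_natCast]
    set r := t ^ (1 / 2 : ℝ) with hr
    have hr1 : 1 ≤ r := Real.one_le_rpow ht1 (by norm_num)
    refine le_of_mul_le_mul_right ?_ hne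
    calc K * (f₀ t ^ x' * f₁ t ^ z') * f₂ t ^ y' ≤
        r ^ (x' + y' + z') * (K * (f₀ t ^ x' * f₁ t ^ z') * f₂ t ^ y') := by
          refine le_mul_of_one_le_left ?_ (one_le_pow₀ hr1)
          have := cosKernel_zero_pos ht
          have := cosKernel_half_pos ht
          positivity
      _ = K * ((r * f₀ t) ^ x' * (r * f₂ t) ^ y' * (r * f₁ t) ^ z') := by
          rw [mul_pow, mul_pow, mul_pow, pow_add, pow_add]; ring
      _ = (r * f₀ t) ^ x * (r * f₂ t) ^ (y' + j + 1) * (r * f₁ t) ^ z := h1.symm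
      _ = _ := by
          rw [mul_pow, mul_pow, mul_pow, hN, pow_add r, pow_add r]; ring
  have l1 := ((((tendsto_cosKernel ((0 : ℝ) : UnitAddCircle)).pow x).mul
    ((tendsto_cosKernel ((1 / 2 : ℝ) : UnitAddCircle)).pow z)).mul
    (tendsto_evenKernel_half.pow j)).mul (tendsto_rpow_mul_evenKernel ((1 / 2 : ℝ) * N))
  have l2 := (((tendsto_cosKernel ((0 : ℝ) : UnitAddCircle)).pow x').mul
    ((tendsto_cosKernel ((1 / 2 : ℝ) : UnitAddCircle)).pow z')).const_mul K
  have := le_of_tendsto_of_tendsto l2 l1 e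
  simp at this
  linarith

/-- The exponent of f₀ is left out: f₀ belongs to the characteristic (0, 0) and does not affect the
sum of characteristics. -/
lemma axis_exponents_eq {x y z x' y' z' : ℕ} {K : ℝ} (hK : 0 < K)
    (h : ∀ t : ℝ, 0 < t → f₀ t ^ x * f₁ t ^ y * f₂ t ^ z = K * (f₀ t ^ x' * f₁ t ^ y' * f₂ t ^ z')) :
    y = y' ∧ z = z' := by
  have h' : ∀ t : ℝ, 0 < t →
      f₀ t ^ x' * f₁ t ^ y' * f₂ t ^ z' = K⁻¹ * (f₀ t ^ x * f₁ t ^ y * f₂ t ^ z) := by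
    intro t ht
    rw [h t ht, ← mul_assoc, inv_mul_cancel₀ hK.ne', one_mul]
  exact ⟨le_antisymm (axis_exponent_one_le hK h) (axis_exponent_one_le (inv_pos.mpr hK) h'),
    le_antisymm (axis_exponent_two_le hK h) (axis_exponent_two_le (inv_pos.mpr hK) h')⟩

lemma prod_axisKernel (S : Finset (Characteristic 2)) (i : Fin 2)
    (hS : ∀ m ∈ S, ¬(m.1 i = 1 ∧ m.2 i = 1)) (e : Characteristic 2 → ℕ) (t : ℝ) :
    ∏ m ∈ S, axisKernel (m.1 i) (m.2 i) t ^ e m =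
      f₀ t ^ (∑ m ∈ S, if m.1 i = 1 ∨ m.2 i = 1 then 0 else e m) *
        f₁ t ^ (∑ m ∈ S, if m.2 i = 1 then e m else 0) *
          f₂ t ^ (∑ m ∈ S, if m.1 i = 1 then e m else 0) := by
  rw [← Finset.prod_pow_eq_pow_sum, ← Finset.prod_pow_eq_pow_sum, ← Finset.prod_pow_eq_pow_sum,
    ← Finset.prod_mul_distrib, ← Finset.prod_mul_distrib]
  refine Finset.prod_congr rfl fun m hm => ?_
  have := hS m hm
  unfold axisKernel
  by_cases h1 : m.1 i = 1 <;> by_cases h2 : m.2 i = 1 <;> simp_all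

end Axis

/-! ### Multiplicative relations between even theta constants. -/

/-- The even characteristics. -/
def evens : Finset (Characteristic 2) := Finset.univ.filter fun m => m.1 ⬝ᵥ m.2 = 0

/-- The even characteristic whose theta constant vanishes on the diagonal. -/
def diagChar : Characteristic 2 := (1, 1)

lemma diagChar_mem : diagChar ∈ evens := by decide

lemma mem_evens_erase : ∀ m ∈ evens.erase diagChar, ∀ i, ¬(m.1 i = 1 ∧ m.2 i = 1) := by
  decide +kernel

lemma diag_mem {t u : ℝ} (ht : 0 < t) (hu : 0 < u) :
    ((Complex.I * t, 0, Complex.I * u) : SymCoord) ∈ siegelCoord := by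
  simp [siegelCoord, ht, mul_pos ht hu]

lemma theta_diag_eq {m : Characteristic 2} (hm : m ∈ evens.erase diagChar) {t u : ℝ} (ht : 0 < t)
    (hu : 0 < u) : theta m (Complex.I * t, 0, Complex.I * u) 0 =
      ((axisKernel (m.1 0) (m.2 0) t * axisKernel (m.1 1) (m.2 1) u : ℝ) : ℂ) := by
  rw [theta_diag m ht hu, thetaAxis_eq (mem_evens_erase m hm 0) ht,
    thetaAxis_eq (mem_evens_erase m hm 1) hu, Complex.ofReal_mul]

lemma theta_diagChar (t u : ℝ) (ht : 0 < t) (hu : 0 < u) :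
    theta diagChar (Complex.I * t, 0, Complex.I * u) 0 = 0 := by
  rw [theta_diag _ ht hu]
  have : thetaAxis (diagChar.1 0) (diagChar.2 0) t = 0 := thetaAxis_one_one t
  rw [this, zero_mul]

lemma lineHolo_prod_pow (S : Finset (Characteristic 2)) (e : Characteristic 2 → ℕ) :
    LineHolo fun P => ∏ m ∈ S, theta m P 0 ^ e m :=
  LineHolo.prod S fun m _ => (lineHolo_theta m).pow (e m)

/-- Cancel the common power of the constant that vanishes on the diagonal; a surplus power on the
left would make the right side vanish there, although its remaining factors are positive on the
diagonal. -/
lemma diagChar_exponent_le {e f : Characteristic 2 → ℕ} {s : ℂ} (hs : s ≠ 0)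
    (h : ∀ P ∈ siegelCoord, ∏ m ∈ evens, theta m P 0 ^ e m = s * ∏ m ∈ evens, theta m P 0 ^ f m) :
    e diagChar ≤ f diagChar := by
  by_contra! hlt
  obtain ⟨j, hj⟩ := Nat.exists_eq_add_of_lt hlt
  have key : ∀ P ∈ siegelCoord, theta diagChar P 0 ^ (j + 1) *
      ∏ m ∈ evens.erase diagChar, theta m P 0 ^ e m =
        s * ∏ m ∈ evens.erase diagChar, theta m P 0 ^ f m := by
    intro P hP
    refine LineHolo.eq_of_mul_eq (F := fun P => theta diagChar P 0 ^ (j + 1) *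
      ∏ m ∈ evens.erase diagChar, theta m P 0 ^ e m)
      (F' := fun P => s * ∏ m ∈ evens.erase diagChar, theta m P 0 ^ f m)
      (((lineHolo_theta _).pow _).mul (lineHolo_prod_pow _ _))
      ((LineHolo.const s).mul (lineHolo_prod_pow _ _)) ((lineHolo_theta diagChar).pow (f diagChar))
      (fun P hP => ?_)
      (LineHolo.exists_pow_ne_zero (exists_theta_ne_zero (m := diagChar) (by decide)) _) hP
    have := h P hP
    rw [← Finset.mul_prod_erase _ _ diagChar_mem, ← Finset.mul_prod_erase _ _ diagChar_mem, hj,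
      add_assoc, pow_add] at this
    linear_combination this
  have h1 := key _ (diag_mem one_pos one_pos)
  rw [theta_diagChar 1 1 one_pos one_pos, zero_pow (Nat.succ_ne_zero j), zero_mul] at h1
  refine mul_ne_zero hs (Finset.prod_ne_zero_iff.mpr fun m hm => pow_ne_zero _ ?_) h1.symm
  rw [theta_diag_eq hm one_pos one_pos, Complex.ofReal_ne_zero]
  exact (mul_pos (axisKernel_pos _ _ one_pos) (axisKernel_pos _ _ one_pos)).ne'

lemma prod_erase_eq {e f : Characteristic 2 → ℕ} {s : ℂ} (hs : s ≠ 0)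
    (h : ∀ P ∈ siegelCoord, ∏ m ∈ evens, theta m P 0 ^ e m = s * ∏ m ∈ evens, theta m P 0 ^ f m) :
    e diagChar = f diagChar ∧ ∀ P ∈ siegelCoord, ∏ m ∈ evens.erase diagChar, theta m P 0 ^ e m =
        s * ∏ m ∈ evens.erase diagChar, theta m P 0 ^ f m := by
  have h' : ∀ P ∈ siegelCoord,
      ∏ m ∈ evens, theta m P 0 ^ f m = s⁻¹ * ∏ m ∈ evens, theta m P 0 ^ e m := by
    intro P hP
    rw [h P hP, ← mul_assoc, inv_mul_cancel₀ hs, one_mul]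
  have heq := le_antisymm (diagChar_exponent_le hs h)
    (diagChar_exponent_le (inv_ne_zero hs) h')
  refine ⟨heq, fun P hP => ?_⟩
  refine LineHolo.eq_of_mul_eq (F := fun P => ∏ m ∈ evens.erase diagChar, theta m P 0 ^ e m)
      (F' := fun P => s * ∏ m ∈ evens.erase diagChar, theta m P 0 ^ f m)
      (lineHolo_prod_pow _ _)
      ((LineHolo.const s).mul (lineHolo_prod_pow _ _)) ((lineHolo_theta diagChar).pow (f diagChar))
      (fun P hP => ?_)
      (LineHolo.exists_pow_ne_zero (exists_theta_ne_zero (m := diagChar) (by decide)) _) hP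
  have := h P hP
  rw [← Finset.mul_prod_erase _ _ diagChar_mem, ← Finset.mul_prod_erase _ _ diagChar_mem, heq]
    at this
  linear_combination this

/-- The exponents of a multiplicative relation on one axis. -/
lemma axis_relation {e f : Characteristic 2 → ℕ} {s : ℂ} (hs : s ≠ 0) (i j : Fin 2)
    (Q : ℝ → SymCoord) (hQ : ∀ t, 0 < t → Q t ∈ siegelCoord)
    (hQθ : ∀ m ∈ evens.erase diagChar, ∀ t, 0 < t → theta m (Q t) 0 =
      ((axisKernel (m.1 i) (m.2 i) t * axisKernel (m.1 j) (m.2 j) 1 : ℝ) : ℂ))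
    (h : ∀ P ∈ siegelCoord, ∏ m ∈ evens.erase diagChar, theta m P 0 ^ e m =
        s * ∏ m ∈ evens.erase diagChar, theta m P 0 ^ f m) :
    (∑ m ∈ evens.erase diagChar, if m.2 i = 1 then e m else 0) =
      (∑ m ∈ evens.erase diagChar, if m.2 i = 1 then f m else 0) ∧
    (∑ m ∈ evens.erase diagChar, if m.1 i = 1 then e m else 0) =
      (∑ m ∈ evens.erase diagChar, if m.1 i = 1 then f m else 0) := by
  set S := evens.erase diagChar
  set C : (Characteristic 2 → ℕ) → ℝ := fun e => ∏ m ∈ S, axisKernel (m.1 j) (m.2 j) 1 ^ e m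
  have hC (e) : 0 < C e := Finset.prod_pos fun m _ => pow_pos (axisKernel_pos _ _ one_pos) _
  have hprod (e : Characteristic 2 → ℕ) (t : ℝ) (ht : 0 < t) : ‖∏ m ∈ S, theta m (Q t) 0 ^ e m‖ =
      (∏ m ∈ S, axisKernel (m.1 i) (m.2 i) t ^ e m) * C e := by
    rw [norm_prod, ← Finset.prod_mul_distrib]
    refine Finset.prod_congr rfl fun m hm => ?_
    rw [norm_pow, hQθ m hm t ht, Complex.norm_real, Real.norm_eq_abs, abs_of_pos
      (mul_pos (axisKernel_pos _ _ ht) (axisKernel_pos _ _ one_pos)), mul_pow]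
  refine axis_exponents_eq (x := ∑ m ∈ S, if m.1 i = 1 ∨ m.2 i = 1 then 0 else e m)
    (x' := ∑ m ∈ S, if m.1 i = 1 ∨ m.2 i = 1 then 0 else f m) (K := ‖s‖ * C f / C e)
    (div_pos (mul_pos (norm_pos_iff.mpr hs) (hC f)) (hC e)) fun t ht => ?_
  have h1 := congrArg norm (h _ (hQ t ht))
  rw [norm_mul, hprod e t ht, hprod f t ht,
    prod_axisKernel S i (fun m hm => mem_evens_erase m hm i),
    prod_axisKernel S i (fun m hm => mem_evens_erase m hm i)] at h1
  rw [div_mul_eq_mul_div, eq_div_iff (hC e).ne', h1]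
  ring

lemma sum_smul_coord (S : Finset (Characteristic 2)) (g : Characteristic 2 → ZMod 2)
    (e : Characteristic 2 → ℕ) :
    ∑ m ∈ S, (e m : ZMod 2) * g m = ((∑ m ∈ S, if g m = 1 then e m else 0 : ℕ) : ZMod 2) := by
  have hz : ∀ x : ZMod 2, x = 0 ∨ x = 1 := by decide
  push_cast
  refine Finset.sum_congr rfl fun m _ => ?_
  rcases hz (g m) with h | h <;> simp [h]

/-- Multiplicatively related products of even theta constants have the same sum of
characteristics. -/
theorem sum_smul_eq_of_prod_eq {e f : Characteristic 2 → ℕ} {s : ℂ} (hs : s ≠ 0)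
    (h : ∀ P ∈ siegelCoord, ∏ m ∈ evens, theta m P 0 ^ e m = s * ∏ m ∈ evens, theta m P 0 ^ f m) :
    ∑ m ∈ evens, e m • m = ∑ m ∈ evens, f m • m := by
  obtain ⟨h0, h1⟩ := prod_erase_eq hs h
  obtain ⟨a1, a2⟩ := axis_relation hs 0 1 (fun t => (Complex.I * t, 0, Complex.I * (1 : ℝ)))
    (fun t ht => diag_mem ht one_pos) (fun m hm t ht => theta_diag_eq hm ht one_pos) h1
  obtain ⟨b1, b2⟩ := axis_relation hs 1 0 (fun t => (Complex.I * (1 : ℝ), 0, Complex.I * t))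
    (fun t ht => diag_mem one_pos ht)
    (fun m hm t ht => by rw [theta_diag_eq hm one_pos ht, mul_comm]) h1
  -- On axis i the exponents of f₂ and f₁ count the characteristics whose first, respectively
  -- second, half has i-th coordinate 1; modulo 2 these counts are the coordinates of the weighted
  -- sum.
  have c (e : Characteristic 2 → ℕ) (i : Fin 2) : (∑ m ∈ evens.erase diagChar, e m • m).1 i =
      ((∑ m ∈ evens.erase diagChar, if m.1 i = 1 then e m else 0 : ℕ) : ZMod 2) := by
    rw [← sum_smul_coord, Prod.fst_sum, Finset.sum_apply]
    simp
  have d (e : Characteristic 2 → ℕ) (i : Fin 2) : (∑ m ∈ evens.erase diagChar, e m • m).2 i =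
      ((∑ m ∈ evens.erase diagChar, if m.2 i = 1 then e m else 0 : ℕ) : ZMod 2) := by
    rw [← sum_smul_coord, Prod.snd_sum, Finset.sum_apply]
    simp
  rw [← Finset.add_sum_erase _ _ diagChar_mem, ← Finset.add_sum_erase _ _ diagChar_mem, h0]
  congr 1
  refine Prod.ext (funext fun i => ?_) (funext fun i => ?_)
  · rw [c, c]
    fin_cases i
    · exact congrArg _ a2
    · exact congrArg _ b2
  · rw [d, d]
    fin_cases i
    · exact congrArg _ a1
    · exact congrArg _ b1

/-! ### Return to matrices. -/

/-- The coordinates of a point of the Siegel upper half-space. -/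
def toCoord (τ : SiegelUpperHalfSpace 2) : SymCoord := (τ.1 0 0, τ.1 0 1, τ.1 1 1)

lemma toCoord_mem (τ : SiegelUpperHalfSpace 2) : toCoord τ ∈ siegelCoord := by
  rw [mem_siegelCoord_iff]
  intro x hx
  have hne : (![x.1, x.2] : Fin 2 → ℝ) ≠ 0 := by
    intro h
    apply hx
    exact Prod.ext (congrFun h 0) (congrFun h 1)
  have h := τ.2.2.dotProduct_mulVec_pos hne
  have hs : τ.1 1 0 = τ.1 0 1 := τ.2.1.apply 0 1
  simp only [Matrix.mulVec, dotProduct, Fin.sum_univ_two, Matrix.map_apply, Pi.star_apply,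
    star_trivial, Matrix.cons_val_zero, Matrix.cons_val_one, hs] at h
  simp only [imForm, toCoord]
  linarith

lemma exists_toCoord_eq {P : SymCoord} (hP : P ∈ siegelCoord) :
    ∃ τ : SiegelUpperHalfSpace 2, toCoord τ = P := by
  refine ⟨⟨!![P.1, P.2.1; P.2.1, P.2.2], ?_, ?_⟩, ?_⟩
  · ext i j
    fin_cases i <;> fin_cases j <;> rfl
  · refine Matrix.PosDef.of_dotProduct_mulVec_pos ?_ fun x hx => ?_
    · ext i j
      fin_cases i <;> fin_cases j <;> rfl
    · have h := mem_siegelCoord_iff.mp hP (x 0, x 1) (by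
        intro h
        apply hx
        ext i
        fin_cases i
        · exact congrArg Prod.fst h
        · exact congrArg Prod.snd h)
      simp only [imForm] at h
      simp [Matrix.mulVec, dotProduct, Fin.sum_univ_two]
      linarith
  · rfl

lemma riemannTheta_eq (m : Characteristic 2) (τ : SiegelUpperHalfSpace 2) (z : Fin 2 → ℂ) :
    riemannTheta m τ z = theta m (toCoord τ) (z 0, z 1) := by
  have hs : τ.1 1 0 = τ.1 0 1 := τ.2.1.apply 0 1
  rw [riemannTheta, theta, thetaInt, ← (finTwoArrowEquiv ℤ).tsum_eq]
  refine tsum_congr fun n => ?_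
  have e : (finTwoArrowEquiv ℤ) n = (n 0, n 1) := rfl
  rw [wterm_thetaWeight, e]
  simp only [Matrix.mulVec, dotProduct, Fin.sum_univ_two, hs, lift, quadForm, thetaLin, cpt,
    shiftPt, intLift, toCoord]
  push_cast
  ring_nf

lemma thetaConstant_eq (m : Characteristic 2) (τ : SiegelUpperHalfSpace 2) :
    thetaConstant m τ = theta m (toCoord τ) 0 :=
  riemannTheta_eq m τ 0

lemma thetaGradient_zero (m : Characteristic 2) (τ : SiegelUpperHalfSpace 2) :
    thetaGradient m τ 0 = thetaGrad m (toCoord τ) (1, 0) := by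
  simp [thetaGradient, thetaGrad, riemannTheta_eq]

lemma thetaGradient_one (m : Characteristic 2) (τ : SiegelUpperHalfSpace 2) :
    thetaGradient m τ 1 = thetaGrad m (toCoord τ) (0, 1) := by
  simp [thetaGradient, thetaGrad, riemannTheta_eq]

lemma jacobianDet_eq (n n' : Characteristic 2) (τ : SiegelUpperHalfSpace 2) :
    jacobianDet n n' τ = 1 / (Real.pi : ℂ) ^ 2 * gradDet n n' (toCoord τ) := by
  simp [jacobianDet, gradDet, Matrix.det_fin_two_of, thetaGradient_zero, thetaGradient_one]

lemma mem_evens {m : Characteristic 2} : m ∈ evens ↔ m.1 ⬝ᵥ m.2 = 0 := by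
  rw [evens, Finset.mem_filter, and_iff_right (Finset.mem_univ _)]

/-! ### Four-plets and Jacobi's formula for the given definitions. -/

section Combinatorics

set_option maxRecDepth 20000
set_option synthInstance.maxHeartbeats 200000
set_option synthInstance.maxSize 2000

lemma fourPlet_card_sum : ∀ s : Characteristic 2, s ≠ 0 →
    (fourPlet s).card = 4 ∧ ∑ m ∈ fourPlet s, m = s := by
  decide +kernel

lemma prod_four_of_ne : ∀ a b c d : Fin 2 → ZMod 2, a ⬝ᵥ b = 1 → c ⬝ᵥ d = 1 → a ≠ c →
    (0, b + d + perp a) ∉ ({(0, b + d + perp c), (a, b + perp c), (c, d + perp a)} :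
      Finset (Characteristic 2)) ∧ (0, b + d + perp c) ∉ ({(a, b + perp c), (c, d + perp a)} :
      Finset (Characteristic 2)) ∧ (a, b + perp c) ∉ ({(c, d + perp a)} :
      Finset (Characteristic 2)) := by
  decide +kernel

lemma prod_four_of_eq : ∀ a c : Fin 2 → ZMod 2, a ≠ 0 → c ≠ 0 → c ≠ a →
    (a + c, 0) ∉ ({(a + c, perp (a + c)), (c, 0), (c, perp c)} : Finset (Characteristic 2)) ∧
    (a + c, perp (a + c)) ∉ ({(c, 0), (c, perp c)} : Finset (Characteristic 2)) ∧
    (c, 0) ∉ ({(c, perp c)} : Finset (Characteristic 2)) := by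
  decide +kernel

lemma sum_evens : ∑ m ∈ evens, m = 0 := by decide +kernel

lemma add_self_char : ∀ m : Characteristic 2, m + m = 0 := by decide

/-- Polarisation of the quadratic form m'm'': for even m, the parity of m + s is affine in m. -/
lemma mem_fourPlet_iff {s m : Characteristic 2} (hm : m ∈ evens) : m ∈ fourPlet s ↔
    s.1 ⬝ᵥ s.2 + (m.1 ⬝ᵥ s.2 + s.1 ⬝ᵥ m.2) = 1 := by
  have h : m.1 ⬝ᵥ m.2 = 0 := mem_evens.mp hm
  simp only [fourPlet, Finset.mem_filter, Finset.mem_univ, true_and, h, Prod.fst_add, Prod.snd_add,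
    add_dotProduct, dotProduct_add, zero_add]
  constructor <;> intro h <;> rw [← h] <;> ring

end Combinatorics

lemma fourPlet_subset (s : Characteristic 2) : fourPlet s ⊆ evens :=
  fun _ hm => mem_evens.mpr (Finset.mem_filter.mp hm).2.1

/-- Jacobi's derivative formula in genus two. -/
theorem jacobianDet_eq_prod {n n' : Characteristic 2} (hn : n.IsOdd) (hn' : n'.IsOdd)
    (hne : n ≠ n') : ∃ s : ℂ, (s = 1 ∨ s = -1) ∧ ∀ τ,
      jacobianDet n n' τ = s * ∏ m ∈ fourPlet (n + n'), theta m (toCoord τ) 0 := by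
  obtain ⟨a, b⟩ := n
  obtain ⟨c, d⟩ := n'
  have hab : a ⬝ᵥ b = 1 := hn
  have hcd : c ⬝ᵥ d = 1 := hn'
  have hpi : (Real.pi : ℂ) ≠ 0 := Complex.ofReal_ne_zero.mpr Real.pi_ne_zero
  by_cases hac : a = c
  · subst hac
    have hbd : b ≠ d := fun h => hne (by rw [h])
    obtain ⟨c, hc, hca⟩ := exists_third a
    obtain ⟨s, hs, h⟩ := gradDet_of_eq hab hcd hbd hc hca
    obtain ⟨i1, i2, i3⟩ := prod_four_of_eq a c (ne_zero_of_dot_eq_one hab) hc hca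
    refine ⟨s, hs, fun τ => ?_⟩
    rw [jacobianDet_eq, h _ (toCoord_mem τ), fourPlet_of_eq a b d c hab hcd hbd hc hca,
      Finset.prod_insert i1, Finset.prod_insert i2, Finset.prod_insert i3, Finset.prod_singleton]
    field_simp
  · obtain ⟨s, hs, h⟩ := gradDet_of_ne hab hcd hac
    obtain ⟨i1, i2, i3⟩ := prod_four_of_ne a b c d hab hcd hac
    refine ⟨s, hs, fun τ => ?_⟩
    rw [jacobianDet_eq, h _ (toCoord_mem τ), fourPlet_of_ne a b c d hab hcd hac,
      Finset.prod_insert i1, Finset.prod_insert i2, Finset.prod_insert i3, Finset.prod_singleton]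
    field_simp

lemma evenCharacteristics_eq : evenCharacteristics = evens := by
  ext m
  simp [evenCharacteristics, evens, Characteristic.IsEven]

lemma sum_smul_indicator {M : Finset (Characteristic 2)} (hM : M ⊆ evens) :
    ∑ m ∈ evens, (if m ∈ M then 1 else 0 : ℕ) • m = ∑ m ∈ M, m := by
  simp only [ite_smul, one_smul, zero_smul]
  rw [← Finset.sum_filter, Finset.filter_mem_eq_inter, Finset.inter_eq_right.mpr hM]

lemma prod_pow_indicator {M : Finset (Characteristic 2)} (hM : M ⊆ evens) (P : SymCoord) :
    ∏ m ∈ evens, theta m P 0 ^ (if m ∈ M then 1 else 0 : ℕ) = ∏ m ∈ M, theta m P 0 := by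
  simp only [pow_ite, pow_one, pow_zero]
  rw [← Finset.prod_filter, Finset.filter_mem_eq_inter, Finset.inter_eq_right.mpr hM]

lemma subset_evens_of_mem {M : Finset (Characteristic 2)} (hM : M ∈ C4Minus) : M ⊆ evens :=
  fun m hm => mem_evens.mpr (hM.2.1 m hm)

/-- If s is the sum of M, then m + s is the sum of the other three elements, hence odd. So M lies in
the 4-plet of s, and both have four elements. -/
lemma eq_fourPlet_of_mem {M : Finset (Characteristic 2)} (hM : M ∈ C4Minus) :
    M = fourPlet (∑ m ∈ M, m) := by
  set s := ∑ m ∈ M, m with hs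
  obtain ⟨hcard, heven, htri⟩ := hM
  have hsub : M ⊆ fourPlet s := by
    intro m hm
    have h3 := (htri (M.erase m) (Finset.erase_subset _ _)
      (by rw [Finset.card_erase_of_mem hm, hcard])).2.2
    have : m + s = ∑ x ∈ M.erase m, x := by
      rw [hs, ← Finset.add_sum_erase _ _ hm, ← add_assoc, add_self_char, zero_add]
    rw [← this] at h3
    exact Finset.mem_filter.mpr ⟨Finset.mem_univ _, heven m hm, h3⟩
  have hs0 : s ≠ 0 := by
    intro h0
    obtain ⟨m, hm⟩ : M.Nonempty := Finset.card_pos.mp (by omega)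
    have h1 := (Finset.mem_filter.mp (hsub hm)).2
    rw [h0, add_zero, h1.1] at h1
    exact absurd h1.2 (by decide)
  exact Finset.eq_of_subset_of_card_le hsub (by rw [(fourPlet_card_sum s hs0).1, hcard])

lemma fourPlet_mem {s : Characteristic 2} (hs : s ≠ 0) : fourPlet s ∈ C4Minus := by
  obtain ⟨hcard, hsum⟩ := fourPlet_card_sum s hs
  refine ⟨hcard, fun m hm => (Finset.mem_filter.mp hm).2.1, fun T hT hT3 =>
    ⟨hT3, fun m hm => (Finset.mem_filter.mp (hT hm)).2.1, ?_⟩⟩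
  have hc : (fourPlet s \ T).card = 1 := by
    rw [Finset.card_sdiff_of_subset hT, hcard, hT3]
  obtain ⟨m, hm⟩ := Finset.card_eq_one.mp hc
  have hmem : m ∈ fourPlet s :=
    (Finset.mem_sdiff.mp (hm ▸ Finset.mem_singleton_self m : m ∈ fourPlet s \ T)).1
  have h := Finset.sum_sdiff (f := fun x => x) hT
  rw [hm, Finset.sum_singleton, hsum] at h
  have : ∑ x ∈ T, x = m + s := by rw [← h, ← add_assoc, add_self_char, zero_add]
  rw [this]
  exact (Finset.mem_filter.mp hmem).2.2

lemma add_ne_zero_char {n n' : Characteristic 2} (h : n ≠ n') : n + n' ≠ 0 := by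
  intro h0
  apply h
  have := congrArg (· + n') h0
  simpa [add_assoc, add_self_char] using this

lemma isFourPlet_fourPlet {n n' : Characteristic 2} (hn : n.IsOdd) (hn' : n'.IsOdd)
    (hne : n ≠ n') : IsFourPlet n n' (fourPlet (n + n')) := by
  obtain ⟨s, hs, h⟩ := jacobianDet_eq_prod hn hn' hne
  refine ⟨fourPlet_mem (add_ne_zero_char hne), ?_⟩
  rcases hs with rfl | rfl
  · left; ext τ; simp [h, thetaConstant_eq, Finset.prod_apply]
  · right; ext τ; simp [h, thetaConstant_eq, Finset.prod_apply]

/-- A second 4-plet would give two proportional products of theta constants, hence equal sums, and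
the sum determines the 4-plet. -/
lemma IsFourPlet.eq_fourPlet {n n' : Characteristic 2} (hn : n.IsOdd) (hn' : n'.IsOdd)
    (hne : n ≠ n') {M : Finset (Characteristic 2)} (hM : IsFourPlet n n' M) :
    M = fourPlet (n + n') := by
  obtain ⟨s, hs, h⟩ := jacobianDet_eq_prod hn hn' hne
  have hs0 : s ≠ 0 := by rcases hs with rfl | rfl <;> simp
  obtain ⟨r, hr0, hr⟩ : ∃ r : ℂ, r ≠ 0 ∧ ∀ τ,
      ∏ m ∈ M, theta m (toCoord τ) 0 = r * jacobianDet n n' τ := by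
    rcases hM.2 with h | h
    · exact ⟨1, one_ne_zero, fun τ => by simp [h, thetaConstant_eq, Finset.prod_apply]⟩
    · exact ⟨-1, by simp, fun τ => by simp [h, thetaConstant_eq, Finset.prod_apply]⟩
  have key := sum_smul_eq_of_prod_eq (e := fun m => if m ∈ M then 1 else 0)
    (f := fun m => if m ∈ fourPlet (n + n') then 1 else 0) (mul_ne_zero hr0 hs0) fun P hP => by
      obtain ⟨τ, rfl⟩ := exists_toCoord_eq hP
      rw [prod_pow_indicator (subset_evens_of_mem hM.1), prod_pow_indicator (fourPlet_subset _),
        hr, h, mul_assoc]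
  rw [sum_smul_indicator (subset_evens_of_mem hM.1), sum_smul_indicator (fourPlet_subset _),
    (fourPlet_card_sum _ (add_ne_zero_char hne)).2] at key
  rw [eq_fourPlet_of_mem hM.1, key]

/-! ### Exponents in products of Jacobian determinants. -/

/-- The exponent of `θ_m` in the product of the Jacobian determinants. -/
def thetaExponent {k : ℕ} (n n' : Fin k → Characteristic 2) (m : Characteristic 2) : ℕ :=
  ∑ i, if m ∈ fourPlet (n i + n' i) then 1 else 0

lemma prod_thetaExponent {k : ℕ} (n n' : Fin k → Characteristic 2) (P : SymCoord) :
    ∏ m ∈ evens, theta m P 0 ^ thetaExponent n n' m =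
      ∏ i, ∏ m ∈ fourPlet (n i + n' i), theta m P 0 := by
  simp only [thetaExponent, ← Finset.prod_pow_eq_pow_sum]
  rw [Finset.prod_comm]
  exact Finset.prod_congr rfl fun i _ => prod_pow_indicator (fourPlet_subset _) P

lemma sum_thetaExponent {k : ℕ} {n n' : Fin k → Characteristic 2} (hne : ∀ i, n i ≠ n' i) :
    ∑ m ∈ evens, thetaExponent n n' m • m = ∑ i, (n i + n' i) := by
  simp only [thetaExponent, Finset.sum_smul]
  rw [Finset.sum_comm]
  refine Finset.sum_congr rfl fun i _ => ?_
  rw [sum_smul_indicator (fourPlet_subset _),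
    (fourPlet_card_sum _ (add_ne_zero_char (hne i))).2]

lemma chiThetaMonomial_eq (h : ℕ) (e : Characteristic 2 → ℕ) (τ : SiegelUpperHalfSpace 2) :
    chiThetaMonomial h e τ = ∏ m ∈ evens, theta m (toCoord τ) 0 ^ (h + 2 * e m) := by
  simp only [chiThetaMonomial, chi5, evenCharacteristics_eq, Pi.mul_apply, Pi.pow_apply,
    Finset.prod_apply, thetaConstant_eq]
  rw [← Finset.prod_pow, ← Finset.prod_mul_distrib]
  exact Finset.prod_congr rfl fun m _ => by rw [pow_add, pow_mul]

lemma isRemarkableFactor_iff {k : ℕ} {n n' : Fin k → Characteristic 2}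
    (hn : ∀ i, (n i).IsOdd) (hn' : ∀ i, (n' i).IsOdd) (hne : ∀ i, n i ≠ n' i) :
    IsRemarkableFactor n n' ↔ ∑ i, (n i + n' i) = 0 := by
  have hsum : ∑ i, ∑ m ∈ fourPlet (n i + n' i), m = ∑ i, (n i + n' i) :=
    Finset.sum_congr rfl fun i _ => (fourPlet_card_sum _ (add_ne_zero_char (hne i))).2
  constructor
  · rintro ⟨M, hM, h⟩
    rw [← hsum, ← h]
    exact Finset.sum_congr rfl fun i _ => by
      rw [(hM i).eq_fourPlet (hn i) (hn' i) (hne i)]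
  · intro h
    exact ⟨fun i => fourPlet (n i + n' i), fun i => isFourPlet_fourPlet (hn i) (hn' i) (hne i),
      hsum.trans h⟩

/-- If the characteristics sum to zero, all the exponents have the same parity. -/
lemma exists_exponents {k : ℕ} {n n' : Fin k → Characteristic 2}
    (hsum : ∑ i, (n i + n' i) = 0) : ∃ h : ℕ, (h = 0 ∨ h = 1) ∧ ∃ e : Characteristic 2 → ℕ,
      ∀ m ∈ evens, thetaExponent n n' m = h + 2 * e m := by
  have hz : ∀ x : ZMod 2, (if x = 1 then 1 else 0 : ZMod 2) = x := by decide
  set q : ZMod 2 := ∑ i, (n i + n' i).1 ⬝ᵥ (n i + n' i).2 with hq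
  -- The characteristic m enters only through its pairing with ∑ (n i + n' i) = 0, so the parity
  -- does not depend on m.
  have hpar (m : Characteristic 2) (hm : m ∈ evens) : (thetaExponent n n' m : ZMod 2) = q := by
    have h1 : ∑ i, (n i + n' i).1 = 0 := by rw [← Prod.fst_sum, hsum]; rfl
    have h2 : ∑ i, (n i + n' i).2 = 0 := by rw [← Prod.snd_sum, hsum]; rfl
    simp only [thetaExponent, mem_fourPlet_iff hm]
    push_cast
    simp only [hz, Finset.sum_add_distrib]
    rw [← dotProduct_sum, ← sum_dotProduct, h1, h2, dotProduct_zero, zero_dotProduct, add_zero,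
      add_zero]
  have hlt := ZMod.val_lt q
  -- Truncated subtraction is harmless for even m, since q.val is the remainder mod 2 of the
  -- exponent.
  refine ⟨q.val, by omega, fun m => (thetaExponent n n' m - q.val) / 2, fun m hm => ?_⟩
  have hv : q.val = thetaExponent n n' m % 2 := by rw [← hpar m hm, ZMod.val_natCast]
  change _ = q.val + 2 * ((thetaExponent n n' m - q.val) / 2)
  omega

/-- Modulo 2 the exponents h + 2e(m) all equal h, and the ten even characteristics sum to zero. -/
lemma sum_eq_zero_of_prod_eq {k : ℕ} {n n' : Fin k → Characteristic 2}
    (hne : ∀ i, n i ≠ n' i) {s : ℂ} (hs : s ≠ 0) {h : ℕ} {e : Characteristic 2 → ℕ}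
    (hprod : ∀ τ, ∏ i, ∏ m ∈ fourPlet (n i + n' i), theta m (toCoord τ) 0 =
      s * chiThetaMonomial h e τ) : ∑ i, (n i + n' i) = 0 := by
  have key := sum_smul_eq_of_prod_eq (e := thetaExponent n n') (f := fun m => h + 2 * e m) hs
    fun P hP => by
      obtain ⟨τ, rfl⟩ := exists_toCoord_eq hP
      rw [prod_thetaExponent, hprod, chiThetaMonomial_eq]
  have h2 (m : Characteristic 2) : (h + 2 * e m) • m = h • m := by
    rw [add_smul, mul_comm, mul_smul, two_smul, add_self_char, smul_zero, add_zero]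
  rw [sum_thetaExponent hne] at key
  rw [key]
  simp only [h2]
  rw [← Finset.smul_sum, sum_evens, smul_zero]

lemma exists_prod_jacobianDet {k : ℕ} {n n' : Fin k → Characteristic 2}
    (hn : ∀ i, (n i).IsOdd) (hn' : ∀ i, (n' i).IsOdd) (hne : ∀ i, n i ≠ n' i) :
    ∃ s : ℂ, (s = 1 ∨ s = -1) ∧ ∀ τ, (∏ i, jacobianDet (n i) (n' i)) τ =
      s * ∏ i, ∏ m ∈ fourPlet (n i + n' i), theta m (toCoord τ) 0 := by
  choose s hs h using fun i => jacobianDet_eq_prod (hn i) (hn' i) (hne i)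
  refine ⟨∏ i, s i, ?_, fun τ => ?_⟩
  · exact Finset.prod_induction s (fun x => x = 1 ∨ x = -1) (fun _ _ => IsSign.mul) (Or.inl rfl)
      fun i _ => hs i
  · rw [Finset.prod_apply, ← Finset.prod_mul_distrib]
    exact Finset.prod_congr rfl fun i _ => h i τ

end ThetaGenusTwo

end

open ThetaGenusTwo in
/-- Let `D(n₁, n₁'), …, D(n_k, n_k')` be the Jacobian determinants of pairwise distinct couples of
odd `2`-characteristics, and `P` their product. -/
theorem mainTheorem11 {k : ℕ} (n n' : Fin k → ThetaGenusTwo.Characteristic 2)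
    (hn : ∀ i, (n i).IsOdd) (hn' : ∀ i, (n' i).IsOdd) (hne : ∀ i, n i ≠ n' i)
    (hdistinct : Function.Injective fun i => s(n i, n' i)) :
    (ThetaGenusTwo.IsRemarkableFactor n n' ↔ ∑ i, (n i + n' i) = 0) ∧
    (ThetaGenusTwo.IsRemarkableFactor n n' ↔
      ∃ h : ℕ, (h = 0 ∨ h = 1) ∧ ∃ e : ThetaGenusTwo.Characteristic 2 → ℕ,
        ∏ i, ThetaGenusTwo.jacobianDet (n i) (n' i) = ThetaGenusTwo.chiThetaMonomial h e ∨
        ∏ i, ThetaGenusTwo.jacobianDet (n i) (n' i) = -ThetaGenusTwo.chiThetaMonomial h e) ∧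
    ((∀ i, ThetaGenusTwo.IsNormalised (n i) (n' i)) →
      (ThetaGenusTwo.IsRemarkableFactor n n' ↔
        ∃ h : ℕ, (h = 0 ∨ h = 1) ∧ ∃ e : ThetaGenusTwo.Characteristic 2 → ℕ,
          ∏ i, ThetaGenusTwo.jacobianDet (n i) (n' i) =
            ThetaGenusTwo.chiThetaMonomial h e)) := by
  have hiff := isRemarkableFactor_iff hn hn' hne
  obtain ⟨s, hs, hP⟩ := exists_prod_jacobianDet hn hn' hne
  have hs0 : s ≠ 0 := by rcases hs with rfl | rfl <;> simp
  have hmono (h : ℕ) (e : Characteristic 2 → ℕ)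
      (he : ∀ m ∈ evens, thetaExponent n n' m = h + 2 * e m) (τ : SiegelUpperHalfSpace 2) :
      ∏ i, ∏ m ∈ fourPlet (n i + n' i), theta m (toCoord τ) 0 = chiThetaMonomial h e τ := by
    rw [← prod_thetaExponent, chiThetaMonomial_eq]
    exact Finset.prod_congr rfl fun m hm => by rw [he m hm]
  have hback : ∀ (h : ℕ) (e : Characteristic 2 → ℕ),
      (∏ i, jacobianDet (n i) (n' i) = chiThetaMonomial h e ∨
        ∏ i, jacobianDet (n i) (n' i) = -chiThetaMonomial h e) → IsRemarkableFactor n n' := by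
    intro h e hor
    rw [hiff]
    rcases hor with h1 | h1
    · refine sum_eq_zero_of_prod_eq hne (inv_ne_zero hs0) (h := h) (e := e) fun τ => ?_
      rw [← h1, hP, ← mul_assoc, inv_mul_cancel₀ hs0, one_mul]
    · refine sum_eq_zero_of_prod_eq hne (neg_ne_zero.mpr (inv_ne_zero hs0)) (h := h) (e := e)
        fun τ => ?_
      have h2 := congrFun h1 τ
      rw [hP, Pi.neg_apply] at h2
      rw [neg_mul, ← mul_neg, ← h2, ← mul_assoc, inv_mul_cancel₀ hs0, one_mul]
  refine ⟨hiff, ⟨fun hr => ?_, fun ⟨h, _, e, hor⟩ => hback h e hor⟩, fun hnorm =>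
    ⟨fun hr => ?_, fun ⟨h, _, e, heq⟩ => hback h e (Or.inl heq)⟩⟩
  · obtain ⟨h, hh, e, he⟩ := exists_exponents (hiff.mp hr)
    refine ⟨h, hh, e, ?_⟩
    rcases hs with rfl | rfl
    · left; ext τ; rw [hP, hmono h e he, one_mul]
    · right; ext τ; rw [hP, hmono h e he, Pi.neg_apply, neg_one_mul]
  · obtain ⟨h, hh, e, he⟩ := exists_exponents (hiff.mp hr)
    refine ⟨h, hh, e, ?_⟩
    ext τ
    rw [← hmono h e he, Finset.prod_apply]
    refine Finset.prod_congr rfl fun i _ => ?_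
    obtain ⟨M, hM, hD⟩ := hnorm i
    -- Normalisation supplies some M with sign +; uniqueness identifies it with the explicit 4-plet,
    -- so no sign arises in the product.
    have hMi := IsFourPlet.eq_fourPlet (hn i) (hn' i) (hne i) (M := M) ⟨hM, Or.inl hD⟩
    rw [hD, hMi, Finset.prod_apply]
    exact Finset.prod_congr rfl fun m _ => thetaConstant_eq m τ
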